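/- \textbf{Setting.} Fix one of the following base rings $\Bbbk$ and, for each $n$, a ring of power series $R_{(\Bbbk^n,o)}$ in $x=(x_1,\dots,x_n)$: (a) $\Bbbk$ a Noetherian local ring (e.g. a field), $R_{(\Bbbk^n,o)}=\Bbbk[[x]]$; (b) $\Bbbk$ a Noetherian Henselian local ring (e.g. a field), $R_{(\Bbbk^n,o)}=\Bbbk\langle x\rangle$, the algebraic power series (the Henselization of $\Bbbk[x]$ at the ideal $\mathfrak m_\Bbbk+(x)$); (c) $\Bbbk$ a complete non-trivially normed field, $R_{(\Bbbk^n,o)}=\Bbbk\{x\}$, the convergent power series; (d) $\Bbbk=K\{\tau_1,\dots,\tau_s\}$ for a complete non-trivially normed field $K$ (a Henselian DVR for $s=1$), $R_{(\Bbbk^n,o)}=K\{\tau,x\}$. A germ $X\subseteq(\Bbbk^n,o)$ is $\operatorname{Spec} R_X$, $R_X=R_{(\Bbbk^n,o)}/J_X$ with $J_X\subseteq(x)$; morphisms $f:X\to Y$ are local homomorphisms of $\Bbbk$-algebras $f^\sharp:R_Y\to R_X$, and $f$ is dominant if $f^\sharp$ is injective. Write $\Omega^{sep}=\Omega/\bigcap_N\mathfrak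 m^N\Omega$ for the separated Kähler differentials of a local ring with maximal ideal $\mathfrak m$. For a dominant $f:X\to Y$ the critical module $\mathcal C_{X,f}$ is the cokernel of $\mathrm{Der}_\Bbbk(R_X)\to \mathrm{Hom}_{R_X}(f^*\Omega^{sep}_{Y/\Bbbk},R_X)$, $\xi\mapsto(dg\mapsto\xi(f^\sharp g))$, and the critical locus is the closed subset $\mathrm{Crit}_X(f)=V(\mathrm{Fitt}_0\,\mathcal C_{X,f})\subseteq X$. For a finite morphism $\pi:Y\to Z$ the ramification locus is $\mathrm{Ram}(\pi)=V(\mathrm{Fitt}_0\,\Omega^{sep}_{Y/Z})\subseteq Y$. A morphism $\pi:Y\to Z$ is called a finite covering if it is finite, $\pi^\sharp:R_Z\to R_Y$ is injective (i.e. $\pi$ is surjective), and for each associated prime $\mathfrak q$ of $R_Y$ with $\mathfrak q\notin\mathrm{Ram}(\pi)$ the ring $(R_Y)_{\mathfrak q}$ is flat over $R_Z$. (If $\Bbbk$ is a domain, e.g. a field, and $Z=(\Bbbk^{m'},o)$, the last condition says that each irreducible or embedded component of $Y$ not contained in $\mathrm{Ram}(\pi)$ dominates $Z$.) \textbf{Lemma.}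 Let $f:X\to Y\subseteq(\Bbbk^m,o)$ be dominant and let $m'\le m$. Suppose the projection $(\Bbbk^m,o)\to(\Bbbk^{m'},o)$, $(y_1,\dots,y_m)\mapsto(y_1,\dots,y_{m'})$, restricts to a finite covering $\pi:Y\to(\Bbbk^{m'},o)$. Suppose $f^{-1}(\mathrm{Ram}(\pi))\subseteq X$ contains no irreducible component of $\mathrm{Crit}_X(f)$ or of $\mathrm{Crit}_X(\pi\circ f)$. Then $\mathrm{Crit}_X(f)=\mathrm{Crit}_X(\pi\circ f)$ as closed subsets of $X$. -/

import Mathlib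

open scoped TensorProduct

universe u

noncomputable section

namespace Germ

/-! ### Rings of formal, analytic and algebraic power series -/

/-- A choice, for every `n`, of a `k`-algebra of power series in `n` variables,
stable under viewing a series in the first `m'` variables as a series in `m` variables. -/
structure SeriesSystem (k : Type u) [CommRing k] where
  ring : ∀ n : ℕ, Subalgebra k (MvPowerSeries (Fin n) k)
  rename_mem : ∀ {m' m : ℕ} (h : m' ≤ m) (g : MvPowerSeries (Fin m') k), g ∈ ring m' →
    MvPowerSeries.rename (Fin.castLEEmb h) g ∈ ring m

/-- Formal power series `k⟦x₁, …, xₙ⟧`. -/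
def formalSystem (k : Type u) [CommRing k] : SeriesSystem k where
  ring _ := ⊤
  rename_mem _ _ _ := Algebra.mem_top

section algebraic

variable {k : Type u} [CommRing k]

/-- `g` is an algebraic power series: it is an element of the image in `k⟦x⟧` of some étale
algebra over `k[x]`. For a henselian local ring `k` (e.g. a field) these series form the
henselization of `k[x]` at the maximal ideal `𝔪_k + (x)`; for a field `k` they are the power
series algebraic over `k[x]`. -/
def IsAlgebraicSeries {n : ℕ} (g : MvPowerSeries (Fin n) k) : Prop :=
  ∃ (B : Type u) (_ : CommRing B) (_ : Algebra (MvPolynomial (Fin n) k) B)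
    (_ : Algebra.Etale (MvPolynomial (Fin n) k) B)
    (φ : B →ₐ[MvPolynomial (Fin n) k] MvPowerSeries (Fin n) k), ∃ b, φ b = g

theorem isAlgebraicSeries_pair {n : ℕ} {g h : MvPowerSeries (Fin n) k}
    (hg : IsAlgebraicSeries g) (hh : IsAlgebraicSeries h) :
    ∃ (B : Type u) (_ : CommRing B) (_ : Algebra (MvPolynomial (Fin n) k) B)
      (_ : Algebra.Etale (MvPolynomial (Fin n) k) B)
      (φ : B →ₐ[MvPolynomial (Fin n) k] MvPowerSeries (Fin n) k),
      (∃ b, φ b = g) ∧ ∃ b, φ b = h := by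
  obtain ⟨B, _, _, _, φ, b, rfl⟩ := hg
  obtain ⟨B', _, _, _, φ', b', rfl⟩ := hh
  refine ⟨B ⊗[MvPolynomial (Fin n) k] B', inferInstance, inferInstance,
    Algebra.Etale.comp _ B _, Algebra.TensorProduct.productMap φ φ',
    ⟨b ⊗ₜ 1, by simp⟩, ⟨1 ⊗ₜ b', by simp⟩⟩

variable (k) in
/-- The algebra `k⟨x₁, …, xₙ⟩` of algebraic power series. -/
def algebraicSeries (n : ℕ) : Subalgebra k (MvPowerSeries (Fin n) k) where
  carrier := {g | IsAlgebraicSeries g}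
  add_mem' := by
    intro g h hg hh
    obtain ⟨B, _, _, _, φ, ⟨b, rfl⟩, ⟨c, rfl⟩⟩ := isAlgebraicSeries_pair hg hh
    exact ⟨B, _, _, ‹_›, φ, b + c, map_add φ b c⟩
  mul_mem' := by
    intro g h hg hh
    obtain ⟨B, _, _, _, φ, ⟨b, rfl⟩, ⟨c, rfl⟩⟩ := isAlgebraicSeries_pair hg hh
    exact ⟨B, _, _, ‹_›, φ, b * c, map_mul φ b c⟩
  algebraMap_mem' := by
    intro a
    refine ⟨MvPolynomial (Fin n) k, inferInstance, inferInstance, inferInstance,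
      Algebra.ofId _ _, MvPolynomial.C a, ?_⟩
    simp [Algebra.ofId_apply, MvPowerSeries.algebraMap_apply, MvPowerSeries.algebraMap_apply']

theorem rename_mem_algebraicSeries {m' m : ℕ} (h : m' ≤ m) (g : MvPowerSeries (Fin m') k)
    (hg : g ∈ algebraicSeries k m') :
    MvPowerSeries.rename (Fin.castLEEmb h) g ∈ algebraicSeries k m := by
  obtain ⟨B, _, _, _, φ, b, rfl⟩ := hg
  let r : MvPolynomial (Fin m') k →+* MvPolynomial (Fin m) k :=
    (MvPolynomial.rename (Fin.castLE h)).toRingHom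
  let _ : Algebra (MvPolynomial (Fin m') k) (MvPolynomial (Fin m) k) := r.toAlgebra
  let _ : Algebra (MvPolynomial (Fin m') k) (MvPowerSeries (Fin m) k) :=
    ((algebraMap (MvPolynomial (Fin m) k) (MvPowerSeries (Fin m) k)).comp r).toAlgebra
  have : IsScalarTower (MvPolynomial (Fin m') k) (MvPolynomial (Fin m) k)
    (MvPowerSeries (Fin m) k) := IsScalarTower.of_algebraMap_eq fun _ => rfl
  have key : ∀ p : MvPolynomial (Fin m') k,
      MvPowerSeries.rename (Fin.castLEEmb h) (p : MvPowerSeries (Fin m') k) =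
        ((MvPolynomial.rename (Fin.castLE h) p : MvPolynomial (Fin m) k) :
          MvPowerSeries (Fin m) k) := by
    intro p
    induction p using MvPolynomial.induction_on with
    | C a => simp
    | add p q hp hq => rw [MvPolynomial.coe_add, map_add, map_add, MvPolynomial.coe_add, hp, hq]
    | mul_X p i hp =>
      rw [MvPolynomial.coe_mul, map_mul, map_mul, MvPolynomial.coe_mul, hp]
      simp
  let ψ : B →ₐ[MvPolynomial (Fin m') k] MvPowerSeries (Fin m) k :=
    { toRingHom := (MvPowerSeries.rename (R := k) (Fin.castLEEmb h)).toRingHom.comp φ.toRingHom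
      commutes' := by
        intro p
        have h1 : φ (algebraMap _ B p) = (p : MvPowerSeries (Fin m') k) := by
          rw [φ.commutes, MvPowerSeries.algebraMap_apply']
          simp
        have h2 : algebraMap (MvPolynomial (Fin m') k) (MvPowerSeries (Fin m) k) p =
            ((MvPolynomial.rename (Fin.castLE h) p : MvPolynomial (Fin m) k) :
              MvPowerSeries (Fin m) k) := by
          change algebraMap (MvPolynomial (Fin m) k) (MvPowerSeries (Fin m) k) (r p) = _
          rw [MvPowerSeries.algebraMap_apply']
          simp [r]
        rw [h2, ← key, ← h1]
        rfl }
  refine ⟨MvPolynomial (Fin m) k ⊗[MvPolynomial (Fin m') k] B, inferInstance, inferInstance,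
    inferInstance, Algebra.TensorProduct.lift (Algebra.ofId _ _) ψ fun _ _ => Commute.all _ _,
    1 ⊗ₜ b, ?_⟩
  simp [ψ]

end algebraic

/-- Algebraic power series `k⟨x₁, …, xₙ⟩`. -/
def algebraicSystem (k : Type u) [CommRing k] : SeriesSystem k where
  ring := algebraicSeries k
  rename_mem := rename_mem_algebraicSeries

section analytic

variable {K : Type u} [NormedField K]

theorem card_antidiagonal_le {n : ℕ} (d : Fin n →₀ ℕ) :
    ((Finset.HasAntidiagonal.antidiagonal d).card : ℝ) ≤ 2 ^ d.degree := by
  have h1 : (Finset.HasAntidiagonal.antidiagonal d).card ≤ (Finset.Iic d).card := by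
    refine Finset.card_le_card_of_injOn Prod.fst ?_ ?_
    · intro p hp
      have := Finset.HasAntidiagonal.mem_antidiagonal.1 hp
      simp only [Finset.coe_Iic, Set.mem_Iic]
      exact this ▸ le_self_add
    · intro p hp q hq hpq
      have h1 := Finset.HasAntidiagonal.mem_antidiagonal.1 hp
      have h2 := Finset.HasAntidiagonal.mem_antidiagonal.1 hq
      refine Prod.ext hpq ?_
      rw [← h2, hpq] at h1
      exact add_left_cancel h1
  have h2 : (Finset.Iic d).card ≤ 2 ^ d.degree := by
    rw [Finsupp.card_Iic, Finsupp.degree_apply, ← Finset.prod_pow_eq_pow_sum]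
    refine Finset.prod_le_prod' fun i _ => ?_
    rw [Nat.card_Iic]
    exact Nat.lt_two_pow_self
  exact_mod_cast h1.trans h2

/-- `g` is a convergent power series: its coefficients grow at most geometrically, i.e. the series
converges absolutely on some polydisc of positive radius. -/
def IsConvergent {n : ℕ} (g : MvPowerSeries (Fin n) K) : Prop :=
  ∃ C ρ : ℝ, 0 ≤ C ∧ 1 ≤ ρ ∧ ∀ d, ‖MvPowerSeries.coeff d g‖ ≤ C * ρ ^ d.degree

variable (K) in
/-- The algebra `K{x₁, …, xₙ}` of convergent power series. -/
def convergentSeries (n : ℕ) : Subalgebra K (MvPowerSeries (Fin n) K) where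
  carrier := {g | IsConvergent g}
  add_mem' := by
    rintro g h ⟨C, ρ, hC, hρ, hg⟩ ⟨C', ρ', hC', hρ', hh⟩
    refine ⟨C + C', max ρ ρ', by positivity, le_max_of_le_left hρ, fun d => ?_⟩
    rw [map_add, add_mul]
    refine (norm_add_le _ _).trans (add_le_add ((hg d).trans ?_) ((hh d).trans ?_))
    · gcongr; exact le_max_left _ _
    · gcongr; exact le_max_right _ _
  mul_mem' := by
    rintro g h ⟨C, ρ, hC, hρ, hg⟩ ⟨C', ρ', hC', hρ', hh⟩
    refine ⟨C * C', 2 * max ρ ρ', by positivity, ?_, fun d => ?_⟩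
    · have := le_max_of_le_left (b := ρ) (c := ρ') hρ
      linarith
    · have hρ0 : (0 : ℝ) ≤ max ρ ρ' := le_trans (by linarith) (le_max_left ρ ρ')
      rw [MvPowerSeries.coeff_mul]
      refine (norm_sum_le _ _).trans ?_
      have : ∀ p ∈ Finset.HasAntidiagonal.antidiagonal d,
          ‖MvPowerSeries.coeff p.1 g * MvPowerSeries.coeff p.2 h‖ ≤
            C * C' * max ρ ρ' ^ d.degree := by
        intro p hp
        rw [← Finset.HasAntidiagonal.mem_antidiagonal.1 hp, map_add, pow_add, norm_mul]
        calc _ ≤ (C * max ρ ρ' ^ p.1.degree) * (C' * max ρ ρ' ^ p.2.degree) := by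
              refine mul_le_mul ((hg _).trans ?_) ((hh _).trans ?_) (norm_nonneg _) (by positivity)
              · gcongr; exact le_max_left _ _
              · gcongr; exact le_max_right _ _
          _ = _ := by ring
      refine (Finset.sum_le_card_nsmul _ _ _ this).trans ?_
      rw [nsmul_eq_mul, mul_pow]
      calc _ ≤ (2 : ℝ) ^ d.degree * (C * C' * max ρ ρ' ^ d.degree) := by
            gcongr; exact card_antidiagonal_le d
        _ = _ := by ring
  algebraMap_mem' := by
    intro a
    refine ⟨‖a‖, 1, norm_nonneg a, le_rfl, fun d => ?_⟩
    classical
    rw [MvPowerSeries.algebraMap_apply, MvPowerSeries.coeff_C]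
    split_ifs <;> simp

theorem coeff_rename_eq {R : Type*} [CommSemiring R] {m' m : ℕ} (h : m' ≤ m)
    (g : MvPowerSeries (Fin m') R) (d : Fin m →₀ ℕ) :
    MvPowerSeries.coeff d (MvPowerSeries.rename (Fin.castLEEmb h) g) = 0 ∨
      ∃ e : Fin m' →₀ ℕ, e.degree = d.degree ∧
        MvPowerSeries.coeff d (MvPowerSeries.rename (Fin.castLEEmb h) g) =
          MvPowerSeries.coeff e g := by
  by_cases hd : d ∈ Set.range (Finsupp.mapDomain (M := ℕ) (Fin.castLEEmb h))
  · obtain ⟨e, rfl⟩ := hd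
    refine Or.inr ⟨e, ?_, ?_⟩
    · rw [Finsupp.degree_mapDomain]
    · rw [← Finsupp.embDomain_eq_mapDomain, MvPowerSeries.coeff_embDomain_rename]
  · exact Or.inl (MvPowerSeries.coeff_rename_eq_zero _ g hd)

theorem rename_mem_convergentSeries {m' m : ℕ} (h : m' ≤ m) (g : MvPowerSeries (Fin m') K)
    (hg : g ∈ convergentSeries K m') :
    MvPowerSeries.rename (Fin.castLEEmb h) g ∈ convergentSeries K m := by
  obtain ⟨C, ρ, hC, hρ, hg⟩ := hg
  refine ⟨C, ρ, hC, hρ, fun d => ?_⟩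
  obtain h0 | ⟨e, he, h1⟩ := coeff_rename_eq h g d
  · rw [h0, norm_zero]; positivity
  · rw [h1, ← he]; exact hg e

/-- A power series in `x` over `K{τ₁, …, τₛ}` which converges jointly in `(τ, x)`. -/
def IsJointlyConvergent {s n : ℕ} (g : MvPowerSeries (Fin n) (convergentSeries K s)) : Prop :=
  ∃ C ρ : ℝ, 0 ≤ C ∧ 1 ≤ ρ ∧ ∀ (d : Fin n →₀ ℕ) (e : Fin s →₀ ℕ),
    ‖MvPowerSeries.coeff e (MvPowerSeries.coeff d g).val‖ ≤
      C * ρ ^ (d.degree + e.degree)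

variable (K) in
/-- The algebra `K{τ₁, …, τₛ, x₁, …, xₙ}` over `K{τ₁, …, τₛ}`. -/
def jointlyConvergentSeries (s n : ℕ) :
    Subalgebra (convergentSeries K s) (MvPowerSeries (Fin n) (convergentSeries K s)) where
  carrier := {g | IsJointlyConvergent g}
  add_mem' := by
    rintro g h ⟨C, ρ, hC, hρ, hg⟩ ⟨C', ρ', hC', hρ', hh⟩
    refine ⟨C + C', max ρ ρ', by positivity, le_max_of_le_left hρ, fun d e => ?_⟩
    rw [map_add, Subalgebra.coe_add, map_add, add_mul]
    refine (norm_add_le _ _).trans (add_le_add ((hg d e).trans ?_) ((hh d e).trans ?_))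
    · gcongr; exact le_max_left _ _
    · gcongr; exact le_max_right _ _
  mul_mem' := by
    rintro g h ⟨C, ρ, hC, hρ, hg⟩ ⟨C', ρ', hC', hρ', hh⟩
    refine ⟨C * C', 2 * max ρ ρ', by positivity, ?_, fun d e => ?_⟩
    · have := le_max_of_le_left (b := ρ) (c := ρ') hρ
      linarith
    · have hρ0 : (0 : ℝ) ≤ max ρ ρ' := le_trans (by linarith) (le_max_left ρ ρ')
      rw [MvPowerSeries.coeff_mul, AddSubmonoidClass.coe_finsetSum, map_sum]
      refine (norm_sum_le _ _).trans ?_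
      have : ∀ p ∈ Finset.HasAntidiagonal.antidiagonal d,
          ‖MvPowerSeries.coeff e (MvPowerSeries.coeff p.1 g * MvPowerSeries.coeff p.2 h).val‖ ≤
            2 ^ e.degree * (C * C' * max ρ ρ' ^ (d.degree + e.degree)) := by
        intro p hp
        rw [Subalgebra.coe_mul, MvPowerSeries.coeff_mul]
        refine (norm_sum_le _ _).trans ?_
        have : ∀ q ∈ Finset.HasAntidiagonal.antidiagonal e,
            ‖MvPowerSeries.coeff q.1 (MvPowerSeries.coeff p.1 g).val *
              MvPowerSeries.coeff q.2 (MvPowerSeries.coeff p.2 h).val‖ ≤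
              C * C' * max ρ ρ' ^ (d.degree + e.degree) := by
          intro q hq
          rw [← Finset.HasAntidiagonal.mem_antidiagonal.1 hp, ← Finset.HasAntidiagonal.mem_antidiagonal.1 hq, map_add, map_add,
            norm_mul]
          calc _ ≤ (C * max ρ ρ' ^ (p.1.degree + q.1.degree)) *
                (C' * max ρ ρ' ^ (p.2.degree + q.2.degree)) := by
                refine mul_le_mul ((hg _ _).trans ?_) ((hh _ _).trans ?_) (norm_nonneg _)
                  (by positivity)
                · gcongr; exact le_max_left _ _
                · gcongr; exact le_max_right _ _
            _ = _ := by ring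
        refine (Finset.sum_le_card_nsmul _ _ _ this).trans ?_
        rw [nsmul_eq_mul]
        gcongr
        exact card_antidiagonal_le e
      refine (Finset.sum_le_card_nsmul _ _ _ this).trans ?_
      rw [nsmul_eq_mul, mul_pow]
      calc _ ≤ (2 : ℝ) ^ d.degree *
            (2 ^ e.degree * (C * C' * max ρ ρ' ^ (d.degree + e.degree))) := by
            gcongr; exact card_antidiagonal_le d
        _ = _ := by ring
  algebraMap_mem' := by
    rintro ⟨a, C, ρ, hC, hρ, ha⟩
    refine ⟨C, ρ, hC, hρ, fun d e => ?_⟩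
    classical
    rw [MvPowerSeries.algebraMap_apply, MvPowerSeries.coeff_C]
    split_ifs with h
    · subst h
      simpa using ha e
    · simp only [ZeroMemClass.coe_zero, map_zero, norm_zero]
      positivity

theorem rename_mem_jointlyConvergentSeries {s m' m : ℕ} (h : m' ≤ m)
    (g : MvPowerSeries (Fin m') (convergentSeries K s))
    (hg : g ∈ jointlyConvergentSeries K s m') :
    MvPowerSeries.rename (Fin.castLEEmb h) g ∈ jointlyConvergentSeries K s m := by
  obtain ⟨C, ρ, hC, hρ, hg⟩ := hg
  refine ⟨C, ρ, hC, hρ, fun d e => ?_⟩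
  obtain h0 | ⟨d', hd', h1⟩ := coeff_rename_eq h g d
  · rw [h0, ZeroMemClass.coe_zero, map_zero, norm_zero]; positivity
  · rw [h1, ← hd']; exact hg d' e

end analytic

/-- Convergent power series `K{x₁, …, xₙ}` over a normed field `K`. -/
def analyticSystem (K : Type u) [NormedField K] : SeriesSystem K where
  ring := convergentSeries K
  rename_mem := rename_mem_convergentSeries

/-- Convergent power series over the local ring `k = K{τ₁, …, τₛ}`, i.e. the rings
`K{τ₁, …, τₛ, x₁, …, xₙ}`; for `s = 1` the ring `k = K{τ}` is a henselian discrete valuation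
ring. -/
def relativeAnalyticSystem (K : Type u) [NormedField K] (s : ℕ) :
    SeriesSystem (convergentSeries K s) where
  ring := jointlyConvergentSeries K s
  rename_mem := rename_mem_jointlyConvergentSeries

/-- The rings of power series in which germs are considered. -/
inductive SeriesSystem.IsGermSystem : {k : Type u} → [CommRing k] → SeriesSystem k → Prop
  | formal (k : Type u) [CommRing k] [IsLocalRing k] [IsNoetherianRing k] :
      IsGermSystem (formalSystem k)
  | algebraic (k : Type u) [CommRing k] [HenselianLocalRing k] [IsNoetherianRing k] :
      IsGermSystem (algebraicSystem k)
  | analytic (K : Type u) [NontriviallyNormedField K] [CompleteSpace K] :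
      IsGermSystem (analyticSystem K)
  | relativeAnalytic (K : Type u) [NontriviallyNormedField K] [CompleteSpace K] (s : ℕ) :
      IsGermSystem (relativeAnalyticSystem K s)

namespace SeriesSystem

variable {k : Type u} [CommRing k] (S : SeriesSystem k)

/-- The ideal `(x₁, …, xₙ)`. -/
def coordIdeal (n : ℕ) : Ideal (S.ring n) :=
  Ideal.span {g | ∃ i : Fin n, (g : MvPowerSeries (Fin n) k) = MvPowerSeries.X i}

/-- The coordinate ring of the germ `V(J) ⊆ (kⁿ, o)`. -/
abbrev GermRing {n : ℕ} (J : Ideal (S.ring n)) : Type u := S.ring n ⧸ J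

/-- The algebra map `S.ring m' → S.ring m` of the projection
`(kᵐ, o) → (kᵐ', o)`, `(y₁, …, yₘ) ↦ (y₁, …, yₘ')`. -/
def coordProjection {m' m : ℕ} (h : m' ≤ m) : S.ring m' →ₐ[k] S.ring m :=
  ((MvPowerSeries.rename (R := k) (Fin.castLEEmb h)).comp (S.ring m').val).codRestrict
    (S.ring m) fun g => S.rename_mem h g g.2

/-- The algebra map of the restriction to `V(J) ⊆ (kᵐ, o)` of the projection
`(y₁, …, yₘ) ↦ (y₁, …, yₘ')`. -/
def projection {m' m : ℕ} (h : m' ≤ m) (J : Ideal (S.ring m)) :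
    S.ring m' →ₐ[k] S.GermRing J :=
  (Ideal.Quotient.mkₐ k J).comp (S.coordProjection h)

end SeriesSystem

/-! ### Fitting ideals, separated differentials, critical and ramification loci -/

/-- The zeroth Fitting ideal of a finitely generated module: the ideal generated by the
determinants of square matrices of relations among the members of a finite generating family. -/
def fittingZero (R M : Type*) [CommRing R] [AddCommGroup M] [Module R M] : Ideal R :=
  Ideal.span {a | ∃ (r : ℕ) (v : Fin r → M) (A : Matrix (Fin r) (Fin r) R),
    Submodule.span R (Set.range v) = ⊤ ∧ (∀ i, ∑ j, A i j • v j = 0) ∧ A.det = a}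

section

variable (k R : Type*) [CommRing k] [CommRing R] [Algebra k R]

/-- The separated Kähler differentials `Ω^sep = Ω / ⋂ 𝔪^N Ω` of a local ring `R` over `k`. (The
Jacobson radical of a local ring is its maximal ideal `𝔪`.) -/
abbrev SepDifferentials : Type _ :=
  Ω[R⁄k] ⧸ (⨅ N : ℕ, (Ideal.jacobson (⊥ : Ideal R)) ^ N • (⊤ : Submodule R (Ω[R⁄k])))

/-- The class `da` in the separated differentials. -/
def sepD (a : R) : SepDifferentials k R :=
  Submodule.Quotient.mk (KaehlerDifferential.D k R a)

end

section

variable {k A B : Type*} [CommRing k] [CommRing A] [CommRing B] [Algebra k A] [Algebra k B]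
  (φ : A →ₐ[k] B)

/-- The tangent module `T_{X→Y} = Hom_X(f^* Ω^sep_Y, R_X)` of `f : X = Spec B → Y = Spec A`:
`B`-linear maps `B ⊗_A Ω^sep_Y → B` are the same as `φ`-semilinear maps `Ω^sep_Y → B`. -/
abbrev TangentModule : Type _ := SepDifferentials k A →ₛₗ[(φ : A →+* B)] B

/-- The image of `Der_X → T_{X→Y}`, where a derivation `ξ` of `B` acts by `da ↦ ξ (φ a)`. -/
def derivationImage : Submodule B (TangentModule φ) where
  carrier := {h | ∃ ξ : Derivation k B B, ∀ a : A, h (sepD k A a) = ξ (φ a)}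
  add_mem' := by
    rintro h h' ⟨ξ, hξ⟩ ⟨ξ', hξ'⟩
    exact ⟨ξ + ξ', fun a => by simp [hξ, hξ']⟩
  zero_mem' := ⟨0, fun a => by simp⟩
  smul_mem' := by
    rintro c h ⟨ξ, hξ⟩
    exact ⟨c • ξ, fun a => by simp [hξ]⟩

/-- The critical module, the cokernel of `Der_X → T_{X→Y}`. -/
abbrev CriticalModule : Type _ := TangentModule φ ⧸ derivationImage φ

variable (k A B) in
/-- The critical locus (as a closed subset of `X`), the zero locus of the zeroth Fitting ideal of
the critical module. -/
def critLocus : Set (PrimeSpectrum B) :=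
  PrimeSpectrum.zeroLocus (fittingZero B (CriticalModule φ) : Set B)

end

section

variable (A B : Type*) [CommRing A] [CommRing B]

/-- The ideal `Fitt₀(Ω^sep_{Y/Z})` of a finite morphism `Y = Spec B → Z = Spec A` (its generic
fibres have dimension zero). -/
def ramIdeal (π : A →+* B) : Ideal B :=
  letI : Algebra A B := π.toAlgebra
  fittingZero B (SepDifferentials A B)

/-- The ramification locus of a finite morphism, as a closed subset of `Y`. -/
def ramLocus (π : A →+* B) : Set (PrimeSpectrum B) :=
  PrimeSpectrum.zeroLocus (ramIdeal A B π : Set B)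

/-- `Y = Spec B → Z = Spec A` is a finite covering: it is finite, surjective (the scheme-theoretic
image, defined by the kernel of `A → B`, is `Z`), and it is flat at the generic point of each
(irreducible or embedded) component of `Y` which is not contained in the ramification locus.
When `A` is a domain, the last condition says that each such component dominates `Z`. -/
structure IsFiniteCovering (π : A →+* B) : Prop where
  finite : π.Finite
  surjective : Function.Injective π
  generic : ∀ q : PrimeSpectrum B, q.asIdeal ∈ associatedPrimes B B → q ∉ ramLocus A B π →
    ((algebraMap B (Localization.AtPrime q.asIdeal)).comp π).Flat

end

/-- `Z` is an irreducible component of the closed set `C`. -/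
def IsIrreducibleComponentOf {T : Type*} [TopologicalSpace T] (Z C : Set T) : Prop :=
  Maximal (fun W : Set T => IsIrreducible W ∧ W ⊆ C) Z

end Germ

end

/-! ### Extending derivations along a finite covering. -/

noncomputable section

/-! Write `A → B → C` for the coordinate rings of `(kᵐ', o)`, `Y` and `X`. A vector field along `f`
restricts to one along `π ∘ f`, and derivations of `C` act compatibly on both sides. It is therefore
enough to compare the two tangent modules off the preimage of `Ram(π)`.

Let `a` lie in the ideal `Fitt₀ Ω^sep` of `π`. Then `a` kills `Ω[B⁄A]`, so a field along `f`
vanishing on `A` is killed by `f a`. Conversely, every `k`-derivation of `A` extends to `B` after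
multiplication by a power of `a` (`exists_derivation_extension_of_finite`): at the associated primes
of `B` avoiding `a` the covering is flat and unramified, hence étale, and there derivations extend
uniquely. Applied to the `∂/∂yᵢ`, this shows that restriction of fields has kernel and cokernel
killed by powers of `f a`. The zero locus of `Fitt₀` of a finite module depends only on its
annihilator, so the two critical loci contain the same primes `p` with `f a ∉ p`
(`Germ.IsFiniteCovering.mem_critLocus_comp_iff`). As no component of either locus lies over
`Ram(π)`, each component is the closure of its part off that set, and the loci coincide
(`Germ.eq_of_irreducible_components_not_subset`).

The rest checks, for each kind of power series, what this argument consumes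
(`Germ.SeriesSystem.IsGermSystem.isRegular`): the rings are Noetherian and local, stable under
partial derivatives, and a derivation along a local map to a Noetherian local ring is determined by
its values on the coordinates. For convergent series, Noetherianity and locality come from a
division theorem (`Germ.exists_division`). For algebraic series, Noetherianity is descended from
formal series through étale charts and Krull's intersection theorem. -/

theorem Algebra.isEtaleAt_of_flat_localization {R S : Type*} [CommRing R] [CommRing S] [Algebra R S]
    [Algebra.FinitePresentation R S] (q : Ideal S) [q.IsPrime]
    [Module.Flat R (Localization.AtPrime q)] [Algebra.IsUnramifiedAt R q] :
    Algebra.IsEtaleAt R q := by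
  let p := q.under R
  let Rp := Localization.AtPrime p
  -- The fibre criterion needs a local base and a finitely presented algebra of which `Sq` is a
  -- localization; `Sp`, the base change of `S` to `Rp`, serves as the latter.
  let Sp := Localization (algebraMapSubmonoid S p.primeCompl)
  let Sq := Localization.AtPrime q
  let := Localization.AtPrime.algebraOfLiesOver p q
  let f : Sp →ₐ[S] Sq := IsLocalization.liftAlgHom (M := algebraMapSubmonoid S p.primeCompl)
        (f := Algebra.ofId _ _) (by
      rintro ⟨_, x, hx, rfl⟩
      simpa using! IsLocalization.map_units (M := q.primeCompl) Sq ⟨algebraMap _ _ x,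
        by simp_all [q.over_def p]⟩)
  algebraize [f.toRingHom]
  have : IsScalarTower R Sp Sq := .to₁₃₄ _ S _ _
  have : IsScalarTower Rp Sp Sq := .of_algebraMap_eq' <| by
    apply IsLocalization.ringHom_ext p.primeCompl
    simp only [RingHom.comp_assoc, ← IsScalarTower.algebraMap_eq]
  have : IsLocalization (algebraMapSubmonoid Sp q.primeCompl) Sq :=
    .isLocalization_of_submonoid_le _ _ (algebraMapSubmonoid S p.primeCompl) _
    (by rintro _ ⟨x, hx, rfl⟩; simp_all [q.over_def p])
  have : FinitePresentation Rp Sp := by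
    have : Algebra.IsPushout R Rp S Sp :=
      .symm <| Algebra.isPushout_of_isLocalization p.primeCompl _ _ _
    exact .equiv (Algebra.IsPushout.equiv R Rp S Sp)
  have : Module.Flat Rp Sq := (Module.flat_iff_of_isLocalization Rp p.primeCompl Sq).mpr ‹_›
  have : Algebra.FormallyUnramified Rp Sq := .of_restrictScalars R Rp Sq
  have : Algebra.EssFiniteType Sp Sq := .of_isLocalization _ (algebraMapSubmonoid Sp q.primeCompl)
  have : Algebra.EssFiniteType Rp Sq := .comp Rp Sp Sq
  -- Over a field, unramified and essentially of finite type implies étale. Flatness then lifts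
  -- smoothness from the closed fibre to `Sq`.
  have : FormallyEtale (IsLocalRing.ResidueField Rp) (IsLocalRing.ResidueField Rp ⊗[Rp] Sq) :=
    .of_formallyUnramified_of_field _ _
  have := FormallySmooth.of_formallySmooth_residueField_tensor
    (R := Rp) (S := Sq) (P := Sp) (algebraMapSubmonoid _ q.primeCompl)
  have : FormallySmooth R Sq := .comp R Rp Sq
  exact FormallyEtale.iff_formallyUnramified_and_formallySmooth.mpr ⟨‹_›, this⟩

/-- For a formally étale algebra, `Ω[T⁄k]` is the base change of `Ω[A⁄k]`, so a linear map on the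
latter extends. -/
theorem Derivation.exists_extension_of_formallyEtale {k A T : Type*} [CommRing k] [CommRing A]
    [CommRing T] [Algebra k A] [Algebra k T] [Algebra A T] [IsScalarTower k A T]
    [Algebra.FormallyEtale A T] (D : Derivation k A A) :
    ∃ E : Derivation k T T, ∀ x, E (algebraMap A T x) = algebraMap A T (D x) := by
  let l : T ⊗[A] Ω[A⁄k] →ₗ[T] T :=
    (KaehlerDifferential.isBaseChange_of_formallyEtale k A T |>.lift
      ((Algebra.linearMap A T).comp D.liftKaehlerDifferential)).comp
      (KaehlerDifferential.tensorKaehlerEquivOfFormallyEtale k A T).toLinearMap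
  let g := (KaehlerDifferential.isBaseChange_of_formallyEtale k A T).lift
      ((Algebra.linearMap A T).comp D.liftKaehlerDifferential)
  refine ⟨g.compDer (KaehlerDifferential.D k T), fun x => ?_⟩
  have := (KaehlerDifferential.isBaseChange_of_formallyEtale k A T).lift_eq
      ((Algebra.linearMap A T).comp D.liftKaehlerDifferential) (KaehlerDifferential.D k A x)
  rw [KaehlerDifferential.map_D] at this
  simpa [g] using this

/-- If `a` vanishes at every associated prime of `B` at which `b` becomes nonzero in the
localization, then a power of `a`, independent of `b`, kills `b`. -/
theorem exists_pow_mul_eq_zero_of_localization {B : Type*} [CommRing B] [IsNoetherianRing B]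
    (a : B) : ∃ N : ℕ, ∀ b : B, (∀ P ∈ associatedPrimes B B, a ∉ P → ∃ s ∉ P, s * b = 0) →
      a ^ N * b = 0 := by
  -- `N` is the point where the annihilators of the powers of `a` become stationary.
  obtain ⟨N, hN⟩ := monotone_stabilizes_iff_noetherian.mpr (inferInstance : IsNoetherian B B)
    ⟨fun n => LinearMap.ker (LinearMap.mulLeft B (a ^ n)), by
      intro i j hij x hx
      obtain ⟨c, rfl⟩ := Nat.exists_eq_add_of_le hij
      simp only [LinearMap.mem_ker, LinearMap.mulLeft_apply] at hx ⊢
      rw [pow_add, mul_right_comm, hx, zero_mul]⟩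
  refine ⟨N, fun b hb => ?_⟩
  by_contra hne
  let M := LinearMap.range (LinearMap.mulLeft B (a ^ N))
  let x : M := ⟨a ^ N * b, b, rfl⟩
  have hx : x ≠ 0 := fun h => hne (congrArg Subtype.val h)
  obtain ⟨P, hP, hle⟩ := exists_le_isAssociatedPrime_of_isNoetherianRing B x hx
  -- `P` is the annihilator of some `a ^ N * z`. If `a ∈ P`, then `a ^ (N + 1) * z = 0`, hence `a ^
  -- N * z = 0` by stationarity, and `P` would be the unit ideal.
  have haP : a ∉ P := by
    intro haP
    obtain ⟨hprime, ⟨_, z, rfl⟩, rfl⟩ := isAssociatedPrime_iff.mp hP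
    rw [Submodule.mem_colon_singleton, Submodule.mem_bot] at haP
    have h0 : a ^ (N + 1) * z = 0 := by
      have := congrArg Subtype.val haP
      simpa [pow_succ', mul_assoc] using this
    have h1 : a ^ N * z = 0 := by
      have := hN (N + 1) (Nat.le_succ N)
      have hz : z ∈ LinearMap.ker (LinearMap.mulLeft B (a ^ (N + 1))) := by simpa using h0
      have hz' : z ∈ LinearMap.ker (LinearMap.mulLeft B (a ^ N)) := by
        exact this.ge hz
      simpa using hz'
    refine hprime.ne_top ((Ideal.eq_top_iff_one _).mpr ?_)
    rw [Submodule.mem_colon_singleton, Submodule.mem_bot, one_smul]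
    exact Subtype.ext h1
  obtain ⟨s, hs, hsb⟩ := hb P (hP.map_of_injective M.subtype M.injective_subtype) haP
  refine hs (hle ?_)
  rw [Submodule.mem_colon_singleton, Submodule.mem_bot]
  refine Subtype.ext ?_
  change s * (a ^ N * b) = 0
  rw [mul_left_comm, hsb, mul_zero]

/-- Extend `D` to the étale localizations of `B`, then clear denominators: the obstruction to
landing in `B` is an `A`-derivation, hence killed by `a`. -/
theorem exists_derivation_extension_of_finite {k A B : Type*} [CommRing k] [CommRing A]
    [CommRing B] [Algebra k A] [Algebra k B] [Algebra A B] [IsScalarTower k A B]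
    [IsNoetherianRing A] [Module.Finite A B] {a : B} (ha : ∀ ω : Ω[B⁄A], a • ω = 0)
    (hflat : ∀ P (_ : P ∈ associatedPrimes B B) (_ : P.IsPrime), a ∉ P →
      Module.Flat A (Localization.AtPrime P))
    (D : Derivation k A A) :
    ∃ (N : ℕ) (E : Derivation k B B),
      ∀ x, E (algebraMap A B x) = a ^ N * algebraMap A B (D x) := by
  have : IsNoetherianRing B := IsNoetherianRing.of_finite A B
  have : Algebra.FinitePresentation A B :=
    (Algebra.FinitePresentation.of_finiteType (R := A) (A := B)).mp inferInstance
  obtain ⟨N, hN⟩ := exists_pow_mul_eq_zero_of_localization a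
  let I := {P : Ideal B // P ∈ associatedPrimes B B ∧ a ∉ P}
  have hI : ∀ P : I, P.1.IsPrime := fun P => P.2.1.1
  have hE : ∀ P : I, ∃ E : Derivation k (Localization.AtPrime P.1) (Localization.AtPrime P.1),
      ∀ x, E (algebraMap A _ x) = algebraMap A _ (D x) := by
    intro P
    have : Module.Flat A (Localization.AtPrime P.1) := hflat P.1 P.2.1 (hI P) P.2.2
    -- `a` kills `Ω[B⁄A]` and is a unit at `P`, so `P` lies outside the support of `Ω[B⁄A]`.
    have : Algebra.IsUnramifiedAt A P.1 := by
      have : (⟨P.1, hI P⟩ : PrimeSpectrum B) ∈ Algebra.unramifiedLocus A B := by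
        rw [Algebra.unramifiedLocus_eq_compl_support, Set.mem_compl_iff,
          Module.notMem_support_iff']
        exact fun m => ⟨a, P.2.2, ha m⟩
      exact this
    have := Algebra.isEtaleAt_of_flat_localization (R := A) P.1
    exact D.exists_extension_of_formallyEtale
  choose E hE using hE
  -- `T` plays the role of a total ring of fractions, restricted to the associated primes avoiding
  -- `a`. The map `B → T` need not be injective, but its kernel is killed by `a ^ N`.
  let T := ∀ P : I, Localization.AtPrime P.1
  let Dt : Derivation k B T := Derivation.mk'
    (LinearMap.pi fun P => ((E P).compAlgebraMap B).toLinearMap) fun x y => by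
      ext P
      exact ((E P).compAlgebraMap B).leibniz x y
  have hDt : ∀ x, Dt (algebraMap A B x) = algebraMap B T (algebraMap A B (D x)) := by
    intro x
    ext P
    have := hE P x
    rw [IsScalarTower.algebraMap_apply A B, IsScalarTower.algebraMap_apply A B] at this
    exact this
  let ι : B →ₗ[B] T := Algebra.linearMap B T
  have hι : ∀ b c, ι b = ι c → a ^ N * b = a ^ N * c := by
    intro b c h
    rw [← sub_eq_zero, ← mul_sub]
    refine hN _ fun P hP haP => ?_
    have := hI ⟨P, hP, haP⟩
    have h1 : algebraMap B (Localization.AtPrime P) (b - c) = 0 := by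
      rw [map_sub, sub_eq_zero]
      exact congrFun h ⟨P, hP, haP⟩
    obtain ⟨s, hs⟩ := (IsLocalization.map_eq_zero_iff P.primeCompl _ _).mp h1
    exact ⟨s, s.2, hs⟩
  -- Modulo the image of `B`, the extended derivation vanishes on `A`. It thus factors through
  -- `Ω[B⁄A]`, which `a` annihilates, so `a • Dt b` comes from `B`.
  let Q := T ⧸ LinearMap.range ι
  let Dq0 : Derivation k B Q := (LinearMap.range ι).mkQ.compDer Dt
  let Dq : Derivation A B Q := Derivation.mk'
    { toFun := Dq0
      map_add' := map_add _
      map_smul' := fun r b => by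
        rw [Algebra.smul_def, Derivation.leibniz]
        have : Dq0 (algebraMap A B r) = 0 := by
          refine (Submodule.Quotient.mk_eq_zero _).mpr ?_
          exact ⟨algebraMap A B (D r), (hDt r).symm⟩
        rw [this, smul_zero, add_zero, algebraMap_smul]
        rfl } fun x y => Dq0.leibniz x y
  have hrange : ∀ b, ∃ c, ι c = a • Dt b := by
    intro b
    have h1 : a • Dq b = 0 := by
      rw [← Dq.liftKaehlerDifferential_comp_D, ← map_smul, ha, map_zero]
    have h2 : (LinearMap.range ι).mkQ (a • Dt b) = 0 := by rw [map_smul]; exact h1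
    exact (Submodule.Quotient.mk_eq_zero _).mp h2
  choose c hc using hrange
  -- One factor `a` brings `Dt` into the image of `B`. The other `N` remove the ambiguity in the
  -- chosen preimage `c`, so that additivity, linearity and the Leibniz rule can be checked in `T`.
  refine ⟨N + 1, Derivation.mk'
    { toFun := fun b => a ^ N * c b
      map_add' := fun x y => by
        rw [← mul_add]
        refine hι _ _ ?_
        rw [map_add, hc, hc, hc, map_add, smul_add]
      map_smul' := fun r x => by
        rw [RingHom.id_apply, Algebra.smul_def, Algebra.smul_def, mul_left_comm]
        refine hι _ _ ?_
        rw [← Algebra.smul_def, ← smul_eq_mul (algebraMap k B r), map_smul, hc, hc, Dt.map_smul, smul_comm,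
          algebraMap_smul] } fun x y => ?_, fun x => ?_⟩
  · change a ^ N * c (x * y) = x * (a ^ N * c y) + y * (a ^ N * c x)
    rw [mul_left_comm, mul_left_comm y, ← mul_add]
    refine hι _ _ ?_
    rw [map_add, ← smul_eq_mul x (c y), ← smul_eq_mul y, map_smul, map_smul, hc, hc, hc,
      Dt.leibniz, smul_add, smul_comm a, smul_comm a]
  · change a ^ N * c (algebraMap A B x) = _
    rw [pow_succ, mul_assoc]
    refine hι _ _ ?_
    rw [hc, hDt, ← smul_eq_mul a, map_smul]
    rfl

/-! ### Fitting ideals and annihilators. -/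

namespace Germ

section fitting

variable {R M : Type*} [CommRing R] [AddCommGroup M] [Module R M]

/-- Cramer's rule: multiplying the relations by the adjugate matrix shows that the determinant kills
every generator. -/
theorem fittingZero_smul_eq_zero {a : R} (ha : a ∈ fittingZero R M) (x : M) : a • x = 0 := by
  induction ha using Submodule.span_induction with
  | zero => exact zero_smul _ _
  | add a b _ _ ha hb => rw [add_smul, ha, hb, add_zero]
  | smul c a _ ha => rw [smul_eq_mul, mul_smul, ha, smul_zero]
  | mem a ha =>
    obtain ⟨r, v, A, hv, hA, rfl⟩ := ha
    have hj : ∀ j, A.det • v j = 0 := by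
      intro j
      have h1 : ∑ i, A.adjugate j i • ∑ l, A i l • v l = 0 := by simp [hA]
      have h2 : ∑ i, A.adjugate j i • ∑ l, A i l • v l =
          ∑ l, (A.adjugate * A) j l • v l := by
        simp_rw [Finset.smul_sum, smul_smul]
        rw [Finset.sum_comm]
        simp_rw [← Finset.sum_smul, Matrix.mul_apply]
      rw [h2, Matrix.adjugate_mul] at h1
      simpa [Matrix.smul_apply, Matrix.one_apply] using h1
    have hx : x ∈ Submodule.span R (Set.range v) := hv ▸ Submodule.mem_top
    induction hx using Submodule.span_induction with
    | zero => exact smul_zero _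
    | add a b _ _ ha hb => rw [smul_add, ha, hb, add_zero]
    | smul c a _ ha => rw [smul_comm, ha, smul_zero]
    | mem a ha => obtain ⟨j, rfl⟩ := ha; exact hj j

/-- If `a` kills `M`, then `a` times the identity matrix is a square matrix of relations on any `r`
generators. -/
theorem exists_pow_mem_fittingZero [Module.Finite R M] {a : R} (ha : ∀ x : M, a • x = 0) :
    ∃ r : ℕ, a ^ r ∈ fittingZero R M := by
  obtain ⟨r, v, hv⟩ := Module.Finite.exists_fin (R := R) (M := M)
  refine ⟨r, Ideal.subset_span ⟨r, v, Matrix.diagonal fun _ => a, hv, fun i => ?_, by simp⟩⟩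
  simp [Matrix.diagonal_apply, ha]

/-- The Fitting ideal and the annihilator have the same zero locus; from here on only annihilators
are used. -/
theorem mem_zeroLocus_fittingZero_iff [Module.Finite R M] (p : PrimeSpectrum R) :
    p ∈ PrimeSpectrum.zeroLocus (fittingZero R M : Set R) ↔
      ∀ a : R, (∀ x : M, a • x = 0) → a ∈ p.asIdeal := by
  rw [PrimeSpectrum.mem_zeroLocus]
  refine ⟨fun h a ha => ?_, fun h a ha => h a (fittingZero_smul_eq_zero ha)⟩
  obtain ⟨r, hr⟩ := exists_pow_mem_fittingZero ha
  exact p.2.mem_of_pow_mem r (h hr)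

end fitting

end Germ

/-! ### Tangent modules and the comparison of critical loci. -/

namespace Germ

section tangent

variable {k A B : Type*} [CommRing k] [CommRing A] [CommRing B] [Algebra k A] [Algebra k B]

theorem TangentModule.ext_sepD {φ : A →ₐ[k] B} {h h' : TangentModule φ}
    (H : ∀ a, h (sepD k A a) = h' (sepD k A a)) : h = h' := by
  refine LinearMap.ext fun x => ?_
  obtain ⟨ω, rfl⟩ := Submodule.Quotient.mk_surjective _ x
  have hω : ω ∈ Submodule.span A (Set.range (KaehlerDifferential.D k A)) :=
    KaehlerDifferential.span_range_derivation k A ▸ Submodule.mem_top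
  induction hω using Submodule.span_induction with
  | zero => rw [Submodule.Quotient.mk_zero, map_zero, map_zero]
  | add x y _ _ hx hy => rw [Submodule.Quotient.mk_add, map_add, map_add, hx, hy]
  | smul c x _ hx => rw [Submodule.Quotient.mk_smul, map_smulₛₗ, map_smulₛₗ, hx]
  | mem x hx => obtain ⟨a, rfl⟩ := hx; exact H a

theorem TangentModule.apply_sepD_mul {φ : A →ₐ[k] B} (h : TangentModule φ) (a b : A) :
    h (sepD k A (a * b)) = φ a * h (sepD k A b) + φ b * h (sepD k A a) := by
  have : sepD k A (a * b) = a • sepD k A b + b • sepD k A a := by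
    simp only [sepD, Derivation.leibniz, Submodule.Quotient.mk_add, Submodule.Quotient.mk_smul]
  rw [this, map_add, map_smulₛₗ, map_smulₛₗ, smul_eq_mul, smul_eq_mul]
  rfl

theorem TangentModule.apply_sepD_add {φ : A →ₐ[k] B} (h : TangentModule φ) (a b : A) :
    h (sepD k A (a + b)) = h (sepD k A a) + h (sepD k A b) := by
  rw [← map_add]
  simp only [sepD, map_add, Submodule.Quotient.mk_add]

theorem TangentModule.apply_sepD_smul {φ : A →ₐ[k] B} (h : TangentModule φ) (c : k) (a : A) :
    h (sepD k A (c • a)) = c • h (sepD k A a) := by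
  have : sepD k A (c • a) = algebraMap k A c • sepD k A a := by
    simp only [sepD, Derivation.map_smul, algebraMap_smul, Submodule.Quotient.mk_smul]
  rw [this, map_smulₛₗ, smul_eq_mul, Algebra.smul_def]
  congr 1
  exact φ.commutes c

/-- A tangent vector field along `φ` as a `k`-linear map satisfying the Leibniz rule. -/
def TangentModule.toLinearMap {φ : A →ₐ[k] B} (h : TangentModule φ) : A →ₗ[k] B where
  toFun a := h (sepD k A a)
  map_add' := h.apply_sepD_add
  map_smul' := h.apply_sepD_smul

variable [IsLocalRing A] [IsLocalRing B]

theorem jacobson_pow_le_comap (φ : A →+* B) [IsLocalHom φ] (N : ℕ) :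
    (Ideal.jacobson (⊥ : Ideal A)) ^ N ≤ ((Ideal.jacobson (⊥ : Ideal B)) ^ N).comap φ := by
  refine le_trans (Ideal.pow_right_mono ?_ N) (Ideal.le_comap_pow φ N)
  rw [IsLocalRing.jacobson_eq_maximalIdeal _ bot_ne_top,
    IsLocalRing.jacobson_eq_maximalIdeal _ bot_ne_top]
  exact ((IsLocalRing.local_hom_TFAE φ).out 0 3).mp ‹_›

theorem iInf_jacobson_pow_eq_bot (R : Type*) [CommRing R] [IsNoetherianRing R] :
    ⨅ N : ℕ, (Ideal.jacobson (⊥ : Ideal R)) ^ N = ⊥ := by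
  have := Ideal.iInf_pow_smul_eq_bot_of_le_jacobson (M := R) (Ideal.jacobson (⊥ : Ideal R)) le_rfl
  simpa using this

/-- Passing to separated differentials loses nothing here: a local map sends `⋂ 𝔪^N Ω` into `⋂
𝔪_B^N`, which is zero by Krull's intersection theorem. -/
theorem TangentModule.exists_of_leibniz [IsNoetherianRing B] (φ : A →ₐ[k] B)
    [IsLocalHom (φ : A →+* B)] (δ : A →ₗ[k] B)
    (hδ : ∀ x y, δ (x * y) = φ x * δ y + φ y * δ x) :
    ∃ h : TangentModule φ, ∀ a, h (sepD k A a) = δ a := by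
  let : Algebra A B := (φ : A →+* B).toAlgebra
  have : IsScalarTower k A B := .of_algebraMap_eq fun c => (φ.commutes c).symm
  let D : Derivation k A B := Derivation.mk' δ hδ
  let l : Ω[A⁄k] →ₛₗ[(φ : A →+* B)] B :=
    { toFun := D.liftKaehlerDifferential
      map_add' := map_add _
      map_smul' := fun a ω => by rw [map_smul, Algebra.smul_def]; rfl }
  refine ⟨Submodule.liftQ _ l fun ω hω => ?_, fun a => ?_⟩
  · rw [LinearMap.mem_ker, ← Submodule.mem_bot B, ← iInf_jacobson_pow_eq_bot B, Submodule.mem_iInf]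
    intro N
    have hN := (Submodule.mem_iInf _).mp hω N
    clear hω
    induction hN using Submodule.smul_induction_on' with
    | smul r hr m _ =>
      rw [map_smulₛₗ, smul_eq_mul]
      exact Ideal.mul_mem_right _ _ (jacobson_pow_le_comap (φ : A →+* B) N hr)
    | add x _ y _ hx hy => rw [map_add]; exact add_mem hx hy
  · exact D.liftKaehlerDifferential_comp_D a

end tangent

section critical

variable {k A B C : Type*} [CommRing k] [CommRing A] [CommRing B] [CommRing C]
  [Algebra k A] [Algebra k B] [Algebra k C]

/-- Evaluation on the finite family `x` embeds the tangent module into a finite free module over a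
Noetherian ring. -/
theorem TangentModule.finite [IsNoetherianRing B] {φ : A →ₐ[k] B} {ι : Type*} [Finite ι]
    (x : ι → A) (hx : ∀ h : TangentModule φ, (∀ i, h (sepD k A (x i)) = 0) → h = 0) :
    Module.Finite B (TangentModule φ) := by
  let e : TangentModule φ →ₗ[B] ι → B :=
    { toFun := fun h i => h (sepD k A (x i))
      map_add' := fun _ _ => rfl
      map_smul' := fun _ _ => rfl }
  refine Module.Finite.of_injective e ((injective_iff_map_eq_zero e).mpr fun h hh => ?_)
  exact hx h fun i => congrFun hh i

theorem mem_critLocus_iff {φ : A →ₐ[k] B} [Module.Finite B (TangentModule φ)]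
    (p : PrimeSpectrum B) : p ∈ critLocus k A B φ ↔
      ∀ c : B, (∀ h : TangentModule φ, c • h ∈ derivationImage φ) → c ∈ p.asIdeal := by
  rw [critLocus, mem_zeroLocus_fittingZero_iff]
  refine forall_congr' fun c => imp_congr_left ⟨fun H h => ?_, fun H x => ?_⟩
  · exact (Submodule.Quotient.mk_eq_zero _).mp (H (Submodule.Quotient.mk h))
  · obtain ⟨h, rfl⟩ := Submodule.Quotient.mk_surjective _ x
    exact (Submodule.Quotient.mk_eq_zero _).mpr (H h)

variable [IsLocalRing A] [IsLocalRing B] [IsLocalRing C] [IsNoetherianRing A]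
  [IsNoetherianRing C]

/-- Restriction along `π` becomes an isomorphism of tangent modules once `f a` is inverted, for any
`a` in the ramification ideal, and it matches the images of the derivations of `C`. The derivations
`D i`, dual to `x`, supply the surjectivity. -/
theorem IsFiniteCovering.mem_critLocus_comp_iff {π : A →ₐ[k] B}
    (hπ : IsFiniteCovering A B (π : A →+* B)) (f : B →ₐ[k] C) [IsLocalHom (f : B →+* C)]
    {ι κ : Type*} [Fintype ι] [Finite κ] (x : ι → A)
    (hx : ∀ h : TangentModule (f.comp π), (∀ i, h (sepD k A (x i)) = 0) → h = 0)
    (y : κ → B) (hy : ∀ h : TangentModule f, (∀ i, h (sepD k B (y i)) = 0) → h = 0)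
    (D : ι → Derivation k A A) (hDx : ∀ i, D i (x i) = 1) (hDx' : ∀ i j, i ≠ j → D i (x j) = 0)
    (p : PrimeSpectrum C)
    (hp : PrimeSpectrum.comap (f : B →+* C) p ∉ ramLocus A B (π : A →+* B)) :
    p ∈ critLocus k B C f ↔ p ∈ critLocus k A C (f.comp π) := by
  classical
  let : Algebra A B := (π : A →+* B).toAlgebra
  have : IsScalarTower k A B := .of_algebraMap_eq fun c => (π.commutes c).symm
  have : Module.Finite A B := hπ.finite
  have : IsNoetherianRing B := .of_finite A B
  have := TangentModule.finite x hx
  have := TangentModule.finite y hy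
  have : IsLocalHom (π : A →+* B) :=
    (RingHom.IsIntegral.of_finite hπ.finite).isLocalHom hπ.surjective
  have : IsLocalHom ((f.comp π : A →ₐ[k] C) : A →+* C) :=
    RingHom.isLocalHom_comp (f : B →+* C) (π : A →+* B)
  obtain ⟨a, ha, hap⟩ : ∃ a ∈ ramIdeal A B (π : A →+* B), f a ∉ p.asIdeal := by
    by_contra! H
    exact hp ((PrimeSpectrum.mem_zeroLocus _ _).mpr H)
  -- `Ω[B⁄A]` is finite over the Noetherian ring `B`, so it is already separated and the quotient is
  -- harmless.
  have haΩ : ∀ ω : Ω[B⁄A], a • ω = 0 := by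
    intro ω
    have h1 : a • (Submodule.Quotient.mk ω : SepDifferentials A B) = 0 :=
      fittingZero_smul_eq_zero ha _
    rw [← Submodule.Quotient.mk_smul, Submodule.Quotient.mk_eq_zero,
      Ideal.iInf_pow_smul_eq_bot_of_le_jacobson _ le_rfl] at h1
    exact h1
  have hflat : ∀ P (_ : P ∈ associatedPrimes B B) (_ : P.IsPrime), a ∉ P →
      Module.Flat A (Localization.AtPrime P) := by
    intro P hP hP' haP
    have := hπ.generic ⟨P, hP'⟩ hP fun h => haP (h ha)
    exact RingHom.flat_algebraMap_iff.mp this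
  have hext := fun i => exists_derivation_extension_of_finite haΩ hflat (D i)
  choose N E hE using hext
  -- restriction of vector fields along `π`
  have hres : ∀ h : TangentModule f, ∃ h' : TangentModule (f.comp π),
      ∀ a, h' (sepD k A a) = h (sepD k B (π a)) := fun h =>
    TangentModule.exists_of_leibniz (f.comp π) (h.toLinearMap.comp π.toLinearMap) fun u v => by
      change h (sepD k B (π (u * v))) = _
      rw [map_mul]
      exact h.apply_sepD_mul _ _
  have hder : ∀ ξ : Derivation k C C, ∃ h : TangentModule f,
      ∀ b, h (sepD k B b) = ξ (f b) := fun ξ =>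
    TangentModule.exists_of_leibniz f (ξ.toLinearMap.comp f.toLinearMap) fun u v => by
      change ξ (f (u * v)) = _
      rw [map_mul, Derivation.leibniz]
      rfl
  have hlift : ∀ i, ∃ h : TangentModule f, ∀ b, h (sepD k B b) = f (E i b) := fun i =>
    TangentModule.exists_of_leibniz f (f.toLinearMap.comp (E i).toLinearMap) fun u v => by
      change f (E i (u * v)) = _
      rw [Derivation.leibniz, map_add, smul_eq_mul, smul_eq_mul, map_mul, map_mul]
      rfl
  choose e he using hlift
  -- a vector field along `f` which vanishes on `A` is killed by `f a`
  have hker : ∀ h : TangentModule f, (∀ u, h (sepD k B (π u)) = 0) → f a • h = 0 := by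
    intro h hh
    let : Algebra B C := (f : B →+* C).toAlgebra
    let : Algebra A C := ((f : B →+* C).comp (algebraMap A B)).toAlgebra
    have : IsScalarTower A B C := .of_algebraMap_eq fun _ => rfl
    let d : Derivation A B C := Derivation.mk'
      { toFun := fun b => h (sepD k B b)
        map_add' := h.apply_sepD_add
        map_smul' := fun u b => by
          rw [Algebra.smul_def, h.apply_sepD_mul]
          erw [hh u]
          rw [mul_zero, add_zero, Algebra.smul_def]
          rfl } h.apply_sepD_mul
    refine TangentModule.ext_sepD fun b => ?_
    have : a • d b = 0 := by
      rw [← d.liftKaehlerDifferential_comp_D, ← map_smul, haΩ, map_zero]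
    exact this
  -- every vector field along `f ∘ π` lifts, up to a power of `f a`
  have hsurj : ∃ M : ℕ, ∀ h : TangentModule (f.comp π), ∃ g : TangentModule f,
      ∀ u, g (sepD k B (π u)) = f a ^ M * h (sepD k A u) := by
    have hN : ∀ i, N i ≤ ∑ j, N j := fun i =>
      Finset.single_le_sum (f := N) (fun _ _ => Nat.zero_le _) (Finset.mem_univ i)
    refine ⟨∑ i, N i, fun h => ?_⟩
    -- `e i` restricts to `f a ^ N i` times the `i`-th coordinate field; the extra powers of `f a`
    -- bring all terms to the common exponent `∑ j, N j`.
    let g : TangentModule f := ∑ i, (f a ^ (∑ j, N j - N i) * h (sepD k A (x i))) • e i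
    obtain ⟨g', hg'⟩ := hres g
    have hgx : ∀ j, g (sepD k B (π (x j))) = f a ^ (∑ j, N j) * h (sepD k A (x j)) := by
      intro j
      simp only [g, LinearMap.sum_apply, LinearMap.smul_apply, he, smul_eq_mul]
      rw [Finset.sum_eq_single j]
      · have := hE j (x j)
        rw [hDx, map_one, mul_one] at this
        erw [this]
        rw [map_pow, mul_right_comm, ← pow_add, Nat.sub_add_cancel (hN j)]
      · intro i _ hij
        have := hE i (x j)
        rw [hDx' i j hij, map_zero, mul_zero] at this
        erw [this]
        rw [map_zero, mul_zero]
      · exact fun hj => absurd (Finset.mem_univ j) hj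
    have h0 : g' - f a ^ (∑ j, N j) • h = 0 := hx _ fun j => by
      rw [LinearMap.sub_apply, hg', hgx, LinearMap.smul_apply, smul_eq_mul, sub_self]
    refine ⟨g, fun u => ?_⟩
    rw [← hg', sub_eq_zero.mp h0, LinearMap.smul_apply, smul_eq_mul]
  obtain ⟨M, hsurj⟩ := hsurj
  -- An annihilator `c` of one critical module becomes an annihilator of the other after
  -- multiplication by a power of `f a`, and `f a ∉ p` allows this power to be cancelled.
  rw [mem_critLocus_iff, mem_critLocus_iff]
  refine ⟨fun H c hc => ?_, fun H c hc => ?_⟩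
  · refine (p.2.mem_or_mem (H (f a * c) fun h => ?_)).resolve_left hap
    obtain ⟨h', hh'⟩ := hres h
    obtain ⟨ξ, hξ⟩ := hc h'
    obtain ⟨g, hg⟩ := hder ξ
    have h0 : f a • (c • h - g) = 0 := by
      refine hker _ fun u => ?_
      rw [LinearMap.sub_apply, hg, LinearMap.smul_apply, ← hh', sub_eq_zero]
      exact hξ u
    rw [smul_sub, sub_eq_zero, smul_smul] at h0
    rw [h0]
    exact (derivationImage f).smul_mem _ ⟨ξ, hg⟩
  · refine (p.2.mem_or_mem (H (f a ^ M * c) fun h => ?_)).resolve_left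
      fun hM => hap (p.2.mem_of_pow_mem M hM)
    obtain ⟨g, hg⟩ := hsurj h
    obtain ⟨ξ, hξ⟩ := hc g
    refine ⟨ξ, fun u => ?_⟩
    have := hξ (π u)
    rw [LinearMap.smul_apply, hg] at this
    rw [LinearMap.smul_apply, mul_comm, mul_smul]
    exact this

end critical

/-! ### Closed sets that agree off a set containing none of their components. -/

/-- Each point lies in a component `W`, and `W \ R` is a nonempty open subset of the irreducible
`W`, hence dense in it. A closed set containing `W \ R` contains `W`. -/
theorem eq_of_irreducible_components_not_subset {T : Type*} [TopologicalSpace T] {Z Z' R : Set T}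
    (hZ : IsClosed Z) (hZ' : IsClosed Z') (hR : IsClosed R)
    (hcomp : ∀ W, IsIrreducibleComponentOf W Z → ¬ W ⊆ R)
    (hcomp' : ∀ W, IsIrreducibleComponentOf W Z' → ¬ W ⊆ R)
    (h : ∀ p ∉ R, p ∈ Z ↔ p ∈ Z') : Z = Z' := by
  have key : ∀ {Z Z' : Set T}, IsClosed Z' → (∀ W, IsIrreducibleComponentOf W Z → ¬ W ⊆ R) →
      (∀ p ∉ R, p ∈ Z → p ∈ Z') → Z ⊆ Z' := by
    intro Z Z' hZ' hcomp h p hp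
    -- A union of a chain of irreducible sets is irreducible, since two points witnessing the
    -- nonempty intersections already lie in one member. Zorn's lemma then gives the component
    -- through `p`.
    have hch : ∀ c ⊆ {W : Set T | IsIrreducible W ∧ W ⊆ Z}, IsChain (· ⊆ ·) c → c.Nonempty →
        ∃ ub ∈ {W : Set T | IsIrreducible W ∧ W ⊆ Z}, ∀ s ∈ c, s ⊆ ub := by
      intro c hc hchain ⟨W₀, hW₀⟩
      refine ⟨⋃₀ c, ⟨⟨(hc hW₀).1.1.mono (Set.subset_sUnion_of_mem hW₀), ?_⟩,
        Set.sUnion_subset fun W hW => (hc hW).2⟩, fun s hs => Set.subset_sUnion_of_mem hs⟩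
      rintro U V hU hV ⟨a, ⟨W₁, hW₁, ha⟩, haU⟩ ⟨b, ⟨W₂, hW₂, hb⟩, hbV⟩
      obtain ⟨W, hW, h1, h2⟩ := hchain.directedOn W₁ hW₁ W₂ hW₂
      obtain ⟨z, hz, hz'⟩ := (hc hW).1.2 U V hU hV ⟨a, h1 ha, haU⟩ ⟨b, h2 hb, hbV⟩
      exact ⟨z, ⟨W, hW, hz⟩, hz'⟩
    obtain ⟨W, hpW, hW⟩ := zorn_subset_nonempty _ hch {p}
      ⟨isIrreducible_singleton, Set.singleton_subset_iff.mpr hp⟩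
    have hdense := hcomp W hW
    obtain ⟨w, hwW, hwR⟩ := Set.not_subset.mp hdense
    by_contra hpZ'
    obtain ⟨z, hzW, hzR, hzZ'⟩ := hW.1.1.2 Rᶜ Z'ᶜ hR.isOpen_compl hZ'.isOpen_compl
      ⟨w, hwW, hwR⟩ ⟨p, hpW rfl, hpZ'⟩
    exact hzZ' (h z hzR (hW.1.2 hzW))
  exact (key hZ' hcomp fun p hp => (h p hp).mp).antisymm
    (key hZ hcomp' fun p hp => (h p hp).mpr)

end Germ

/-! ### Division of convergent power series. -/

namespace Germ

section weight

/-- The weight `∏ pᵢ ^ dᵢ` of the monomial `x ^ d`, where `pᵢ` is the `i`-th prime number. It is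
multiplicative and separates monomials. -/
def weight {n : ℕ} (d : Fin n →₀ ℕ) : ℕ := ∏ i : Fin n, Nat.nth Nat.Prime i ^ d i

variable {n : ℕ}

theorem weight_zero : weight (0 : Fin n →₀ ℕ) = 1 := by simp [weight]

theorem weight_add (d e : Fin n →₀ ℕ) : weight (d + e) = weight d * weight e := by
  simp [weight, pow_add, Finset.prod_mul_distrib]

theorem weight_pos (d : Fin n →₀ ℕ) : 0 < weight d :=
  Finset.prod_pos fun i _ => pow_pos (Nat.prime_nth_prime i).pos _

/-- Unique factorization recovers each exponent as a prime valuation. -/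
theorem weight_injective : Function.Injective (weight : (Fin n →₀ ℕ) → ℕ) := by
  intro d e h
  ext i
  have key : ∀ d : Fin n →₀ ℕ, (weight d).factorization (Nat.nth Nat.Prime i) = d i := by
    intro d
    rw [weight, Nat.factorization_prod_apply fun (j : Fin n) _ => pow_ne_zero _ (Nat.prime_nth_prime j).ne_zero,
      Finset.sum_eq_single i]
    · rw [Nat.factorization_pow, Finsupp.smul_apply, (Nat.prime_nth_prime i).factorization_self,
        smul_eq_mul, mul_one]
    · intro j _ hj
      rw [Nat.factorization_pow, Finsupp.smul_apply, Nat.factorization_eq_zero_of_not_dvd, smul_zero]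
      intro hdvd
      refine hj (Fin.ext ?_)
      exact (Nat.nth_injective Nat.infinite_setOfPred_prime
        ((Nat.prime_dvd_prime_iff_eq (Nat.prime_nth_prime i) (Nat.prime_nth_prime j)).mp hdvd)).symm
    · exact fun hi => absurd (Finset.mem_univ i) hi
  rw [← key d, ← key e, h]

theorem two_pow_degree_le_weight (d : Fin n →₀ ℕ) : 2 ^ d.degree ≤ weight d := by
  rw [Finsupp.degree_eq_sum, ← Finset.prod_pow_eq_pow_sum]
  exact Finset.prod_le_prod' fun i _ => Nat.pow_le_pow_left (Nat.prime_nth_prime i).two_le _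

theorem weight_le_pow_degree (d : Fin n →₀ ℕ) :
    weight d ≤ (∏ i : Fin n, Nat.nth Nat.Prime i) ^ d.degree := by
  rw [Finsupp.degree_eq_sum, ← Finset.prod_pow_eq_pow_sum]
  refine Finset.prod_le_prod' fun i _ => Nat.pow_le_pow_left ?_ _
  exact Nat.le_of_dvd (Finset.prod_pos fun j _ => (Nat.prime_nth_prime j).pos)
    (Finset.dvd_prod_of_mem _ (Finset.mem_univ i))

/-- Well-founded recursion on the weight. The value `0` outside smaller weights is only a filler: it
is harmless when `G d` ignores those entries. -/
theorem exists_of_weight_recursion {K : Type*} [Zero K]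
    (G : (Fin n →₀ ℕ) → ((Fin n →₀ ℕ) → K) → K) :
    ∃ u : (Fin n →₀ ℕ) → K, ∀ d, u d = G d fun e => if weight e < weight d then u e else 0 := by
  let F : ∀ d : Fin n →₀ ℕ, (∀ e, weight e < weight d → K) → K := fun d ih =>
    G d fun e => if h : weight e < weight d then ih e h else 0
  refine ⟨(measure weight).wf.fix F, fun d => ?_⟩
  rw [WellFounded.fix_eq]
  rfl

end weight

section division

variable {K : Type u} [NormedField K] {n : ℕ}

open MvPowerSeries in
-- The weight lies between `2 ^ degree` and a fixed power base to the degree, so geometric growth in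
-- the degree is polynomial growth in the weight. The weight can thus serve both as monomial order
-- and as the measure of size.
theorem isConvergent_iff_weight {g : MvPowerSeries (Fin n) K} :
    IsConvergent g ↔ ∃ (C : ℝ) (t : ℕ), 0 ≤ C ∧ ∀ d, ‖coeff d g‖ ≤ C * (weight d : ℝ) ^ t := by
  constructor
  · rintro ⟨C, ρ, hC, hρ, h⟩
    obtain ⟨t, ht⟩ := pow_unbounded_of_one_lt ρ (one_lt_two (α := ℝ))
    refine ⟨C, t, hC, fun d => (h d).trans ?_⟩
    gcongr
    calc ρ ^ d.degree ≤ ((2 : ℝ) ^ t) ^ d.degree := by gcongr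
      _ = ((2 : ℝ) ^ d.degree) ^ t := pow_right_comm _ _ _
      _ ≤ _ := by
        gcongr
        exact_mod_cast two_pow_degree_le_weight d
  · rintro ⟨C, t, hC, h⟩
    refine ⟨C, ((∏ i : Fin n, Nat.nth Nat.Prime i : ℕ) : ℝ) ^ t, hC, ?_, fun d => (h d).trans ?_⟩
    · refine one_le_pow₀ ?_
      exact_mod_cast Finset.prod_pos fun (j : Fin n) _ => (Nat.prime_nth_prime j).pos
    · rw [pow_right_comm]
      gcongr
      exact_mod_cast weight_le_pow_degree d

theorem IsConvergent.exists_forall_ge {g : MvPowerSeries (Fin n) K} (hg : IsConvergent g) :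
    ∃ (C : ℝ) (t₀ : ℕ), 0 ≤ C ∧ ∀ t ≥ t₀, ∀ d,
      ‖MvPowerSeries.coeff d g‖ ≤ C * (weight d : ℝ) ^ t := by
  obtain ⟨C, t, hC, h⟩ := isConvergent_iff_weight.mp hg
  refine ⟨C, t, hC, fun t' ht' d => (h d).trans ?_⟩
  gcongr
  exact_mod_cast weight_pos d

/-- If all exponents of `h` have weight greater than `w`, then the norm of `h` is small compared with
`w ^ t` for large `t`. -/
theorem IsConvergent.exists_sum_le {h : MvPowerSeries (Fin n) K} (hh : IsConvergent h) (w : ℕ)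
    (hw : ∀ b, MvPowerSeries.coeff b h ≠ 0 → w < weight b) {ε : ℝ} (hε : 0 < ε) :
    ∃ t₀, ∀ t ≥ t₀, ∀ F : Finset (Fin n →₀ ℕ),
      ∑ b ∈ F, ‖MvPowerSeries.coeff b h‖ * ((w : ℝ) / weight b) ^ t ≤ ε := by
  obtain ⟨C, t₁, hC, hb⟩ := isConvergent_iff_weight.mp hh
  have hsum : Summable fun m : ℕ => 1 / (m : ℝ) ^ 2 :=
    Real.summable_one_div_nat_pow.mpr one_lt_two
  set S := ∑' m : ℕ, 1 / (m : ℝ) ^ 2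
  have hS : 0 ≤ S := tsum_nonneg fun m => by positivity
  -- Weights are integers, so a weight above `w` is at least `w + 1` and the ratios stay uniformly
  -- below `1`.
  set θ : ℝ := w / (w + 1)
  have hθ0 : 0 ≤ θ := by positivity
  have hθ1 : θ < 1 := by
    rw [div_lt_one (by positivity)]
    linarith
  have hlim : Filter.Tendsto (fun s : ℕ => C * (w : ℝ) ^ (t₁ + 2) * θ ^ s * S) Filter.atTop
      (nhds 0) := by
    have := ((tendsto_pow_atTop_nhds_zero_of_lt_one hθ0 hθ1).const_mul
      (C * (w : ℝ) ^ (t₁ + 2))).mul_const S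
    simpa using this
  obtain ⟨s₀, hs₀⟩ := Filter.eventually_atTop.mp (hlim.eventually (ge_mem_nhds hε))
  refine ⟨t₁ + 2 + s₀, fun t ht F => ?_⟩
  -- The `t₁` factors absorb the growth of the coefficients, two more give a summable series since
  -- distinct exponents have distinct weights, and the remaining `s` make the sum small.
  obtain ⟨s, rfl⟩ : ∃ s, t = t₁ + 2 + s := ⟨t - (t₁ + 2), by omega⟩
  refine le_trans ?_ (hs₀ s (by omega))
  have hterm : ∀ b ∈ F, ‖MvPowerSeries.coeff b h‖ * ((w : ℝ) / weight b) ^ (t₁ + 2 + s) ≤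
      C * (w : ℝ) ^ (t₁ + 2) * θ ^ s * (1 / (weight b : ℝ) ^ 2) := by
    intro b _
    by_cases h0 : MvPowerSeries.coeff b h = 0
    · rw [h0, norm_zero, zero_mul]
      positivity
    have hwb : ((w : ℝ) + 1) ≤ weight b := by exact_mod_cast hw b h0
    have hwb0 : (0 : ℝ) < weight b := by exact_mod_cast weight_pos b
    calc _ ≤ (C * (weight b : ℝ) ^ t₁) * ((w : ℝ) / weight b) ^ (t₁ + 2 + s) := by
          gcongr
          exact hb b
      _ = C * (w : ℝ) ^ (t₁ + 2) * ((w : ℝ) / weight b) ^ s * (1 / (weight b : ℝ) ^ 2) := by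
          rw [pow_add, pow_add, div_pow, div_pow, div_pow]
          field_simp
          ring
      _ ≤ _ := by
          gcongr
          exact div_le_div_of_nonneg_left (by positivity) (by positivity) hwb
  refine (Finset.sum_le_sum hterm).trans ?_
  rw [← Finset.mul_sum]
  gcongr
  have := hsum.sum_le_tsum (F.image weight) fun m _ => by positivity
  rwa [Finset.sum_image weight_injective.injOn] at this

open MvPowerSeries in
theorem isConvergent_monomial (e : Fin n →₀ ℕ) : IsConvergent (monomial e (1 : K)) := by
  classical
  refine ⟨1, 1, zero_le_one, le_rfl, fun d => ?_⟩
  rw [coeff_monomial]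
  split_ifs <;> simp

open MvPowerSeries in
/-- Division with remainder by convergent power series `f j` with leading exponents `e j`. -/
theorem exists_division {ι : Type*} [Fintype ι] (f : ι → MvPowerSeries (Fin n) K)
    (hf : ∀ j, IsConvergent (f j)) (e : ι → Fin n →₀ ℕ) (he : ∀ j, coeff (e j) (f j) = 1)
    (hw : ∀ j b, coeff b (f j) ≠ 0 → b ≠ e j → weight (e j) < weight b)
    {g : MvPowerSeries (Fin n) K} (hg : IsConvergent g) :
    ∃ (q : ι → MvPowerSeries (Fin n) K) (r : MvPowerSeries (Fin n) K),
      (∀ j, IsConvergent (q j)) ∧ IsConvergent r ∧ g = ∑ j, q j * f j + r ∧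
        ∀ d j, e j ≤ d → coeff d r = 0 := by
  classical
  let h : ι → MvPowerSeries (Fin n) K := fun j => f j - monomial (e j) 1
  have hh : ∀ j, IsConvergent (h j) := fun j =>
    (convergentSeries K n).sub_mem (hf j) (isConvergent_monomial (e j))
  have hhw : ∀ j b, coeff b (h j) ≠ 0 → weight (e j) < weight b := by
    intro j b hb
    have hbe : b ≠ e j := by
      rintro rfl
      simp [h, he] at hb
    refine hw j b ?_ hbe
    simpa [h, coeff_monomial, hbe] using hb
  -- Each monomial divisible by some leading monomial is assigned to one divisor `j`; the unassigned
  -- monomials form the remainder.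
  have hsel : ∃ sel : (Fin n →₀ ℕ) → Option ι, (∀ d j, sel d = some j → e j ≤ d) ∧
      ∀ d, sel d = none → ∀ j, ¬ e j ≤ d := by
    refine ⟨fun d => if H : ∃ j, e j ≤ d then some H.choose else none, fun d j hd => ?_,
      fun d hd => ?_⟩
    · dsimp only at hd
      split_ifs at hd with H
      rw [← Option.some.inj hd]
      exact H.choose_spec
    · dsimp only at hd
      split_ifs at hd with H
      exact fun j hj => H ⟨j, hj⟩
  obtain ⟨sel, hsel, hsel'⟩ := hsel
  let Q : ((Fin n →₀ ℕ) → K) → ι → MvPowerSeries (Fin n) K :=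
    fun u j a => if sel (a + e j) = some j then u (a + e j) else 0
  have hQ : ∀ u j a, coeff a (Q u j) = if sel (a + e j) = some j then u (a + e j) else 0 :=
    fun _ _ _ => rfl
  -- `u` is to be the coefficient family of `∑ j, q j * x ^ e j + r`, that is, of `g - ∑ j, q j * h
  -- j`. Since `h j` has only weights above that of `e j`, the coefficient at `d` involves `u` only
  -- at smaller weights.
  obtain ⟨u, hu⟩ := exists_of_weight_recursion (K := K) fun (d : Fin n →₀ ℕ) v =>
    coeff d g - ∑ j, ∑ p ∈ Finset.HasAntidiagonal.antidiagonal d,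
      coeff p.1 (Q v j) * coeff p.2 (h j)
  have hlt : ∀ d j, ∀ p ∈ Finset.HasAntidiagonal.antidiagonal d, coeff p.2 (h j) ≠ 0 →
      weight (p.1 + e j) < weight d := by
    intro d j p hp h0
    rw [← Finset.HasAntidiagonal.mem_antidiagonal.1 hp, weight_add, weight_add]
    exact Nat.mul_lt_mul_of_pos_left (hhw j _ h0) (weight_pos _)
  have hu' : ∀ d, u d = coeff d g - ∑ j, ∑ p ∈ Finset.HasAntidiagonal.antidiagonal d,
      coeff p.1 (Q u j) * coeff p.2 (h j) := by
    intro d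
    rw [hu d]
    congr 1
    refine Finset.sum_congr rfl fun j _ => Finset.sum_congr rfl fun p hp => ?_
    by_cases h0 : coeff p.2 (h j) = 0
    · rw [h0, mul_zero, mul_zero]
    · change (if sel (p.1 + e j) = some j then
          (if weight (p.1 + e j) < weight d then u (p.1 + e j) else 0) else 0) * _ =
        (if sel (p.1 + e j) = some j then u (p.1 + e j) else 0) * _
      rw [if_pos (hlt d j p hp h0)]
  let r : MvPowerSeries (Fin n) K := fun d => if sel d = none then u d else 0
  have hr : ∀ d, coeff d r = if sel d = none then u d else 0 := fun _ => rfl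
  have hsplit : ∀ d, u d = ∑ j, coeff d (Q u j * monomial (e j) 1) + coeff d r := by
    intro d
    have h1 : ∀ j, coeff d (Q u j * monomial (e j) 1) = if sel d = some j then u d else 0 := by
      intro j
      rw [coeff_mul_monomial]
      by_cases hj : e j ≤ d
      · rw [if_pos hj, mul_one, hQ, tsub_add_cancel_of_le hj]
      · rw [if_neg hj, if_neg fun H => hj (hsel d j H)]
    simp_rw [h1, hr]
    cases hd : sel d with
    | none => simp
    | some j => simp
  -- the coefficients of `u` grow at most geometrically
  obtain ⟨C, t₀, hC, hgb⟩ := hg.exists_forall_ge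
  -- With this bound for each divisor, all the corrections together contribute at most half of the
  -- bound being proved; the `+ 1` covers an empty family.
  have hε : (0 : ℝ) < 1 / (2 * (Fintype.card ι + 1)) := by positivity
  choose s hs using fun j => (hh j).exists_sum_le (weight (e j)) (hhw j) hε
  obtain ⟨t, ht₀, ht⟩ : ∃ t, t₀ ≤ t ∧ ∀ j, s j ≤ t :=
    ⟨t₀ + ∑ j, s j, le_self_add, fun j => le_add_left
      (Finset.single_le_sum (f := s) (fun _ _ => Nat.zero_le _) (Finset.mem_univ j))⟩
  -- In `2 * C`, one half bounds the coefficient of `g` and the other half bounds the corrections.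
  have hub : ∀ N, ∀ d, weight d = N → ‖u d‖ ≤ 2 * C * (weight d : ℝ) ^ t := by
    intro N
    induction N using Nat.strong_induction_on with
    | _ N ih =>
      intro d hd
      have hwd : (0 : ℝ) < weight d := by exact_mod_cast weight_pos d
      have hj : ∀ j, ‖∑ p ∈ Finset.HasAntidiagonal.antidiagonal d,
          coeff p.1 (Q u j) * coeff p.2 (h j)‖ ≤
          2 * C * (weight d : ℝ) ^ t * (1 / (2 * (Fintype.card ι + 1))) := by
        intro j
        have hp : ∀ p ∈ Finset.HasAntidiagonal.antidiagonal d,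
            ‖coeff p.1 (Q u j) * coeff p.2 (h j)‖ ≤ 2 * C * (weight d : ℝ) ^ t *
              (‖coeff p.2 (h j)‖ * ((weight (e j) : ℝ) / weight p.2) ^ t) := by
          intro p hp
          by_cases h0 : coeff p.2 (h j) = 0
          · rw [h0, mul_zero, norm_zero, zero_mul, mul_zero]
          have hQb : ‖coeff p.1 (Q u j)‖ ≤ 2 * C * (weight (p.1 + e j) : ℝ) ^ t := by
            rw [hQ]
            split_ifs
            · exact ih _ (hd ▸ hlt d j p hp h0) _ rfl
            · rw [norm_zero]; positivity
          have hwp : (0 : ℝ) < weight p.2 := by exact_mod_cast weight_pos p.2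
          rw [norm_mul]
          refine (mul_le_mul_of_nonneg_right hQb (norm_nonneg _)).trans (le_of_eq ?_)
          rw [← Finset.HasAntidiagonal.mem_antidiagonal.1 hp, weight_add, weight_add]
          push_cast
          rw [div_pow, mul_pow, mul_pow]
          field_simp
        refine (norm_sum_le _ _).trans ((Finset.sum_le_sum hp).trans ?_)
        rw [← Finset.mul_sum]
        gcongr
        have hinj : Set.InjOn Prod.snd
            (Finset.HasAntidiagonal.antidiagonal d : Set ((Fin n →₀ ℕ) × (Fin n →₀ ℕ))) := by
          intro p hp q hq hpq
          have h1 := Finset.HasAntidiagonal.mem_antidiagonal.1 hp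
          have h2 := Finset.HasAntidiagonal.mem_antidiagonal.1 hq
          refine Prod.ext ?_ hpq
          rw [← h2, hpq] at h1
          exact add_right_cancel h1
        have := hs j t (ht j) ((Finset.HasAntidiagonal.antidiagonal d).image Prod.snd)
        rwa [Finset.sum_image hinj] at this
      rw [hu' d]
      refine (norm_sub_le _ _).trans ?_
      refine (add_le_add (hgb t ht₀ d) ((norm_sum_le _ _).trans
        (Finset.sum_le_sum fun j _ => hj j))).trans ?_
      rw [Finset.sum_const, Finset.card_univ, nsmul_eq_mul]
      have hle : (Fintype.card ι : ℝ) * (1 / (2 * (Fintype.card ι + 1))) ≤ 1 / 2 := by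
        rw [mul_one_div, div_le_div_iff₀ (by positivity) (by positivity)]
        linarith
      calc _ = C * (weight d : ℝ) ^ t + 2 * C * (weight d : ℝ) ^ t *
            ((Fintype.card ι : ℝ) * (1 / (2 * (Fintype.card ι + 1)))) := by ring
        _ ≤ C * (weight d : ℝ) ^ t + 2 * C * (weight d : ℝ) ^ t * (1 / 2) := by gcongr
        _ = _ := by ring
  refine ⟨Q u, r, fun j => ?_, ?_, ?_, fun d j hj => ?_⟩
  · refine isConvergent_iff_weight.mpr ⟨2 * C * (weight (e j) : ℝ) ^ t, t, by positivity,
      fun a => ?_⟩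
    rw [hQ]
    split_ifs
    · refine (hub _ _ rfl).trans (le_of_eq ?_)
      rw [weight_add]
      push_cast
      ring
    · rw [norm_zero]; positivity
  · refine isConvergent_iff_weight.mpr ⟨2 * C, t, by positivity, fun d => ?_⟩
    rw [hr]
    split_ifs
    · exact hub _ _ rfl
    · rw [norm_zero]; positivity
  · ext d
    have h1 : coeff d g = u d + ∑ j, coeff d (Q u j * h j) := by
      rw [hu' d]
      simp_rw [coeff_mul]
      ring
    rw [h1, hsplit d, map_add, map_sum, add_right_comm, ← Finset.sum_add_distrib]
    congr 1
    refine Finset.sum_congr rfl fun j _ => ?_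
    rw [← map_add, ← mul_add]
    congr 2
    simp [h]
  · rw [hr, if_neg fun H => hsel' d H j hj]

open MvPowerSeries in
/-- A nonzero series, scaled so that its term of least weight has coefficient `1`. -/
theorem exists_leading_exponent {g : MvPowerSeries (Fin n) K} (hg : g ≠ 0) :
    ∃ e, coeff e g ≠ 0 ∧ ∀ b, coeff b g ≠ 0 → b ≠ e → weight e < weight b := by
  obtain ⟨e, he, hmin⟩ := WellFounded.has_min (measure (weight (n := n))).wf
    {e | coeff e g ≠ 0} (by
      by_contra H
      rw [Set.not_nonempty_iff_eq_empty, Set.eq_empty_iff_forall_notMem] at H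
      refine hg (MvPowerSeries.ext fun d => ?_)
      simpa using H d)
  refine ⟨e, he, fun b hb hbe => lt_of_le_of_ne ?_ fun H => hbe (weight_injective H).symm⟩
  exact not_lt.mp (hmin b hb)

open MvPowerSeries in
-- Divide `1` by the normalized series: its leading exponent is `0`, which lies below every
-- exponent, so the remainder vanishes.
theorem isUnit_convergentSeries {g : convergentSeries K n}
    (hg : constantCoeff g.1 ≠ 0) : IsUnit g := by
  set c := constantCoeff g.1
  have hcg : IsConvergent (c⁻¹ • g).1 := (c⁻¹ • g).2
  obtain ⟨q, r, hq, -, h, hr⟩ := exists_division (ι := Unit) (fun _ => (c⁻¹ • g).1)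
    (fun _ => hcg) (fun _ => 0)
    (fun _ => by simpa [c] using inv_mul_cancel₀ hg)
    (fun _ b _ hb => by
      rw [weight_zero]
      refine lt_of_le_of_ne (weight_pos b) fun H => hb (weight_injective ?_)
      rw [weight_zero]
      exact H.symm)
    (convergentSeries K n).one_mem
  have hr0 : r = 0 := MvPowerSeries.ext fun d => hr d () (zero_le)
  refine IsUnit.of_mul_eq_one (c⁻¹ • ⟨q (), hq ()⟩) (Subtype.ext ?_)
  rw [hr0, add_zero] at h
  simpa [mul_comm] using h.symm

instance isLocalRing_convergentSeries : IsLocalRing (convergentSeries K n) := by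
  refine IsLocalRing.of_nonunits_add fun {a b} ha hb hab => ?_
  have key : ∀ {g : convergentSeries K n}, g ∈ nonunits (convergentSeries K n) →
      MvPowerSeries.constantCoeff g.1 = 0 := fun hg => by
    by_contra H
    exact hg (isUnit_convergentSeries H)
  have h1 : MvPowerSeries.constantCoeff (a + b).1 = 0 := by
    rw [Subalgebra.coe_add, map_add, key ha, key hb, add_zero]
  have h2 := (hab.map (convergentSeries K n).val).map MvPowerSeries.constantCoeff
  exact not_isUnit_zero (h1 ▸ h2)

open MvPowerSeries in
-- A standard basis argument: by Dickson's lemma the leading exponents of `I` have finitely many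
-- minimal elements, and elements of `I` realizing them generate `I` by division.
instance isNoetherianRing_convergentSeries : IsNoetherianRing (convergentSeries K n) := by
  refine ⟨fun I => ?_⟩
  let E : Set (Fin n →₀ ℕ) := {e | ∃ g ∈ I, coeff e g.1 = 1 ∧
    ∀ b, coeff b g.1 ≠ 0 → b ≠ e → weight e < weight b}
  have hE : E.IsPWO := Set.isPWO_of_wellQuasiOrderedLE E
  have hfin : {e | Minimal (· ∈ E) e}.Finite :=
    (setOfPred_minimal_antichain (· ∈ E)).finite_of_partiallyWellOrderedOn
      (hE.mono fun e he => he.1)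
  have := hfin.fintype
  choose f hfI hf1 hfw using fun e : {e | Minimal (· ∈ E) e} => e.2.1
  refine (Submodule.fg_def.mpr ⟨Set.range f, Set.finite_range f, le_antisymm ?_ fun g hg => ?_⟩)
  · exact Submodule.span_le.mpr (Set.range_subset_iff.mpr hfI)
  · obtain ⟨q, r, hq, hr, h, hr0⟩ := exists_division (fun e => (f e).1) (fun e => (f e).2)
      (fun e => e.1) hf1 hfw g.2
    have hgq : g = ∑ e, (⟨q e, hq e⟩ : convergentSeries K n) * f e + ⟨r, hr⟩ :=
      Subtype.ext (by simpa using h)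
    have hmem : ∑ e, (⟨q e, hq e⟩ : convergentSeries K n) * f e ∈
        Submodule.span (convergentSeries K n) (Set.range f) :=
      Submodule.sum_mem _ fun e _ =>
        Submodule.smul_mem _ _ (Submodule.subset_span (Set.mem_range_self e))
    have hrI : (⟨r, hr⟩ : convergentSeries K n) ∈ I := by
      have h1 : (⟨r, hr⟩ : convergentSeries K n) =
        g - ∑ e, (⟨q e, hq e⟩ : convergentSeries K n) * f e := by rw [hgq]; ring
      rw [h1]
      exact I.sub_mem hg (Submodule.span_le.mpr (Set.range_subset_iff.mpr hfI) hmem)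
    -- The remainder lies in `I`. If it were nonzero, its leading exponent would dominate a minimal
    -- one, where the coefficients of the remainder vanish.
    have hr00 : r = 0 := by
      by_contra hne
      obtain ⟨e, he, hmin⟩ := exists_leading_exponent hne
      have heE : e ∈ E := by
        refine ⟨(coeff e r)⁻¹ • ⟨r, hr⟩, I.smul_of_tower_mem _ hrI, ?_, fun b hb => hmin b ?_⟩
        · simpa using inv_mul_cancel₀ he
        · simp at hb
          exact hb.2
      obtain ⟨e', hle, he'⟩ := hE.exists_le_minimal heE
      exact he (hr0 e ⟨e', he'⟩ hle)
    subst hr00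
    rw [hgq]
    refine Submodule.add_mem _ hmem ?_
    exact Submodule.zero_mem _

end division

end Germ

/-! ### Series converging jointly in parameters and variables. -/

namespace Germ

section append

variable {s n : ℕ}

/-- The exponent of the monomial `τ ^ e * x ^ d`. -/
def appendExp (e : Fin s →₀ ℕ) (d : Fin n →₀ ℕ) : Fin (s + n) →₀ ℕ :=
  Finsupp.equivFunOnFinite.symm (Fin.append e d)

def fstExp (a : Fin (s + n) →₀ ℕ) : Fin s →₀ ℕ :=
  Finsupp.equivFunOnFinite.symm fun i => a (Fin.castAdd n i)

def sndExp (a : Fin (s + n) →₀ ℕ) : Fin n →₀ ℕ :=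
  Finsupp.equivFunOnFinite.symm fun i => a (Fin.natAdd s i)

@[simp] theorem fstExp_appendExp (e : Fin s →₀ ℕ) (d : Fin n →₀ ℕ) :
    fstExp (appendExp e d) = e := by
  ext i; simp [fstExp, appendExp]

@[simp] theorem sndExp_appendExp (e : Fin s →₀ ℕ) (d : Fin n →₀ ℕ) :
    sndExp (appendExp e d) = d := by
  ext i; simp [sndExp, appendExp]

@[simp] theorem appendExp_fstExp_sndExp (a : Fin (s + n) →₀ ℕ) :
    appendExp (fstExp a) (sndExp a) = a := by
  ext i
  refine Fin.addCases (fun i => ?_) (fun i => ?_) i <;> simp [fstExp, sndExp, appendExp]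

theorem fstExp_add (a b : Fin (s + n) →₀ ℕ) : fstExp (a + b) = fstExp a + fstExp b := by
  ext i; simp [fstExp]

theorem sndExp_add (a b : Fin (s + n) →₀ ℕ) : sndExp (a + b) = sndExp a + sndExp b := by
  ext i; simp [sndExp]

theorem appendExp_add (e e' : Fin s →₀ ℕ) (d d' : Fin n →₀ ℕ) :
    appendExp (e + e') (d + d') = appendExp e d + appendExp e' d' := by
  ext i
  refine Fin.addCases (fun i => ?_) (fun i => ?_) i <;> simp [appendExp]

theorem degree_appendExp (e : Fin s →₀ ℕ) (d : Fin n →₀ ℕ) :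
    (appendExp e d).degree = e.degree + d.degree := by
  simp [Finsupp.degree_eq_sum, appendExp, Fin.sum_univ_add]

@[simp] theorem appendExp_eq_zero {e : Fin s →₀ ℕ} {d : Fin n →₀ ℕ} :
    appendExp e d = 0 ↔ e = 0 ∧ d = 0 := by
  rw [← Finsupp.degree_eq_zero_iff, degree_appendExp, Nat.add_eq_zero_iff,
    Finsupp.degree_eq_zero_iff, Finsupp.degree_eq_zero_iff]

theorem sum_antidiagonal_appendExp {M : Type*} [AddCommMonoid M] (e : Fin s →₀ ℕ)
    (d : Fin n →₀ ℕ) (F : (Fin (s + n) →₀ ℕ) × (Fin (s + n) →₀ ℕ) → M) :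
    ∑ p ∈ Finset.HasAntidiagonal.antidiagonal (appendExp e d), F p =
      ∑ p ∈ Finset.HasAntidiagonal.antidiagonal d, ∑ q ∈ Finset.HasAntidiagonal.antidiagonal e,
        F (appendExp q.1 p.1, appendExp q.2 p.2) := by
  rw [← Finset.sum_product']
  refine Finset.sum_nbij' (fun p => ((sndExp p.1, sndExp p.2), (fstExp p.1, fstExp p.2)))
    (fun p => (appendExp p.2.1 p.1.1, appendExp p.2.2 p.1.2)) ?_ ?_ ?_ ?_ ?_
  · intro p hp
    rw [Finset.HasAntidiagonal.mem_antidiagonal] at hp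
    simp [← fstExp_add, ← sndExp_add, hp]
  · intro p hp
    simp only [Finset.mem_product, Finset.HasAntidiagonal.mem_antidiagonal] at hp
    simp [← appendExp_add, hp.1, hp.2]
  · intro p _; simp
  · intro p _; simp
  · intro p _; simp

end append

section jointly

variable {K : Type u} [NormedField K] {s n : ℕ}

open MvPowerSeries in
theorem IsConvergent.coeff_appendExp {g : MvPowerSeries (Fin (s + n)) K} (hg : IsConvergent g)
    (d : Fin n →₀ ℕ) :
    IsConvergent (fun e => coeff (appendExp e d) g : MvPowerSeries (Fin s) K) := by
  obtain ⟨C, ρ, hC, hρ, h⟩ := hg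
  refine ⟨C * ρ ^ d.degree, ρ, by positivity, hρ, fun e => (h (appendExp e d)).trans ?_⟩
  rw [degree_appendExp, pow_add]
  exact le_of_eq (by ring)

/-- View a series in `(τ, x)` as a series in `x` over `K{τ}`. -/
def splitSeries (g : convergentSeries K (s + n)) :
    MvPowerSeries (Fin n) (convergentSeries K s) :=
  fun d => ⟨fun e => MvPowerSeries.coeff (appendExp e d) g.1, g.2.coeff_appendExp d⟩

theorem coeff_coeff_splitSeries (g : convergentSeries K (s + n)) (d : Fin n →₀ ℕ)
    (e : Fin s →₀ ℕ) :
    MvPowerSeries.coeff e (MvPowerSeries.coeff d (splitSeries g)).1 =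
      MvPowerSeries.coeff (appendExp e d) g.1 := rfl

theorem ext_coeff_coeff {f g : MvPowerSeries (Fin n) (convergentSeries K s)}
    (h : ∀ d e, MvPowerSeries.coeff e (MvPowerSeries.coeff d f).1 =
      MvPowerSeries.coeff e (MvPowerSeries.coeff d g).1) : f = g :=
  MvPowerSeries.ext fun d => Subtype.ext (MvPowerSeries.ext fun e => h d e)

theorem isJointlyConvergent_splitSeries (g : convergentSeries K (s + n)) :
    IsJointlyConvergent (splitSeries g) := by
  obtain ⟨C, ρ, hC, hρ, h⟩ := g.2
  refine ⟨C, ρ, hC, hρ, fun d e => ?_⟩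
  rw [coeff_coeff_splitSeries, add_comm d.degree, ← degree_appendExp]
  exact h _

variable (K s n) in
def splitSeriesHom : convergentSeries K (s + n) →+* jointlyConvergentSeries K s n where
  toFun g := ⟨splitSeries g, isJointlyConvergent_splitSeries g⟩
  map_one' := by
    classical
    refine Subtype.ext (ext_coeff_coeff fun d e => ?_)
    change MvPowerSeries.coeff (appendExp e d) (1 : MvPowerSeries (Fin (s + n)) K) =
      MvPowerSeries.coeff e
        (MvPowerSeries.coeff d (1 : MvPowerSeries (Fin n) (convergentSeries K s))).1
    rw [MvPowerSeries.coeff_one, MvPowerSeries.coeff_one]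
    by_cases hd : d = 0
    · rw [if_pos hd, Subalgebra.coe_one, MvPowerSeries.coeff_one]
      simp [hd]
    · rw [if_neg hd, Subalgebra.coe_zero, map_zero, if_neg]
      simp [hd]
  map_zero' := rfl
  map_add' _ _ := rfl
  map_mul' f g := by
    refine Subtype.ext (ext_coeff_coeff fun d e => ?_)
    change MvPowerSeries.coeff (appendExp e d) (f.1 * g.1) =
      MvPowerSeries.coeff e (MvPowerSeries.coeff d (splitSeries f * splitSeries g)).1
    rw [MvPowerSeries.coeff_mul, sum_antidiagonal_appendExp, MvPowerSeries.coeff_mul,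
      AddSubmonoidClass.coe_finsetSum, map_sum]
    refine Finset.sum_congr rfl fun p _ => ?_
    rw [Subalgebra.coe_mul, MvPowerSeries.coeff_mul]
    rfl

/-- Regrouping monomials makes `K{τ, x}` map onto the jointly convergent series, so that they
inherit Noetherianity and locality. -/
theorem splitSeriesHom_surjective : Function.Surjective (splitSeriesHom K s n) := by
  rintro ⟨G, C, ρ, hC, hρ, h⟩
  refine ⟨⟨fun a => MvPowerSeries.coeff (fstExp a) (MvPowerSeries.coeff (sndExp a) G).1,
    C, ρ, hC, hρ, fun a => ?_⟩, Subtype.ext (ext_coeff_coeff fun d e => ?_)⟩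
  · refine (h (sndExp a) (fstExp a)).trans (le_of_eq ?_)
    rw [add_comm, ← degree_appendExp, appendExp_fstExp_sndExp]
  · change MvPowerSeries.coeff (fstExp (appendExp e d))
      (MvPowerSeries.coeff (sndExp (appendExp e d)) G).1 = _
    rw [fstExp_appendExp, sndExp_appendExp]

instance isNoetherianRing_jointlyConvergentSeries :
    IsNoetherianRing (jointlyConvergentSeries K s n) :=
  isNoetherianRing_of_surjective _ _ (splitSeriesHom K s n) splitSeriesHom_surjective

instance nontrivial_jointlyConvergentSeries : Nontrivial (jointlyConvergentSeries K s n) := by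
  refine ⟨⟨1, 0, fun H => ?_⟩⟩
  have h : (1 : MvPowerSeries (Fin n) (convergentSeries K s)) = 0 := congrArg Subtype.val H
  exact one_ne_zero h

instance isLocalRing_jointlyConvergentSeries : IsLocalRing (jointlyConvergentSeries K s n) := by
  refine IsLocalRing.of_isUnit_or_isUnit_one_sub_self (R := jointlyConvergentSeries K s n) fun b => ?_
  obtain ⟨a, rfl⟩ := splitSeriesHom_surjective b
  refine (IsLocalRing.isUnit_or_isUnit_one_sub_self a).imp (fun h => h.map (splitSeriesHom K s n))
    fun h => ?_
  have := h.map (splitSeriesHom K s n)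
  rwa [map_sub, map_one] at this

end jointly

end Germ

/-- A map satisfying the Leibniz rule along a homomorphism from an unramified algebra is determined
by its restriction to the base ring. -/
theorem eq_zero_of_leibniz_of_formallyUnramified {A B R : Type*} [CommRing A] [CommRing B]
    [CommRing R] [Algebra A B] [Algebra.FormallyUnramified A B] (φ : B →+* R) (δ : B →+ R)
    (hδ : ∀ x y, δ (x * y) = φ x * δ y + φ y * δ x) (h0 : ∀ a, δ (algebraMap A B a) = 0) (b : B) :
    δ b = 0 := by
  let : Algebra B R := φ.toAlgebra
  let : Algebra A R := (φ.comp (algebraMap A B)).toAlgebra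
  have : IsScalarTower A B R := .of_algebraMap_eq fun _ => rfl
  let d : Derivation A B R := Derivation.mk'
    { toFun := δ
      map_add' := δ.map_add
      map_smul' := fun a b => by
        rw [Algebra.smul_def, hδ, h0, mul_zero, add_zero, RingHom.id_apply, Algebra.smul_def]
        rfl } hδ
  have : d b = 0 := by
    rw [← d.liftKaehlerDifferential_comp_D, Subsingleton.elim (KaehlerDifferential.D A B b) 0,
      map_zero]
  exact this

/-! ### Algebraic power series through étale charts. -/

namespace Germ

section charts

variable {k : Type u} [CommRing k] {n : ℕ}

theorem coeff_algebraMap_mvPolynomial (p : MvPolynomial (Fin n) k) (d : Fin n →₀ ℕ) :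
    MvPowerSeries.coeff d (algebraMap _ (MvPowerSeries (Fin n) k) p) = p.coeff d := by
  rw [MvPowerSeries.algebraMap_apply']
  simp

/-- The ideal of series of order at least `N`. -/
def orderIdeal (k : Type u) [CommRing k] (n N : ℕ) : Ideal (MvPowerSeries (Fin n) k) where
  carrier := {f | ∀ d, d.degree < N → MvPowerSeries.coeff d f = 0}
  zero_mem' := fun _ _ => rfl
  add_mem' := fun {a b} ha hb d hd => by rw [map_add, ha d hd, hb d hd, add_zero]
  smul_mem' := fun c f hf d hd => by
    rw [smul_eq_mul, MvPowerSeries.coeff_mul]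
    refine Finset.sum_eq_zero fun p hp => ?_
    rw [hf p.2, mul_zero]
    rw [← Finset.HasAntidiagonal.mem_antidiagonal.1 hp, map_add] at hd
    omega

section

variable {B : Type u} [CommRing B] [Algebra (MvPolynomial (Fin n) k) B]
  (φ : B →ₐ[MvPolynomial (Fin n) k] MvPowerSeries (Fin n) k)

variable (k n B) in
/-- The ideal generated by the coordinates in an algebra over the polynomial ring. -/
abbrev varsIdeal : Ideal B :=
  (MvPolynomial.idealOfVars (Fin n) k).map (algebraMap (MvPolynomial (Fin n) k) B)

/-- The composition of `φ` with evaluation at the origin. -/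
def evalZero : B →+* k := (MvPowerSeries.constantCoeff).comp (φ : B →+* MvPowerSeries (Fin n) k)

theorem evalZero_algebraMap (p : MvPolynomial (Fin n) k) :
    evalZero φ (algebraMap _ B p) = MvPolynomial.constantCoeff p := by
  change MvPowerSeries.constantCoeff (φ (algebraMap _ B p)) = _
  rw [φ.commutes, ← MvPowerSeries.coeff_zero_eq_constantCoeff_apply, coeff_algebraMap_mvPolynomial]
  rfl

theorem sub_C_constantCoeff_mem (p : MvPolynomial (Fin n) k) :
    p - MvPolynomial.C (MvPolynomial.constantCoeff p) ∈ MvPolynomial.idealOfVars (Fin n) k := by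
  rw [← pow_one (MvPolynomial.idealOfVars (Fin n) k), MvPolynomial.mem_pow_idealOfVars_iff']
  intro d hd
  obtain rfl : d = 0 := (Finsupp.degree_eq_zero_iff d).mp (by omega)
  simp [MvPolynomial.constantCoeff_eq]

theorem apply_mem_orderIdeal {N : ℕ} {b : B} (hb : b ∈ varsIdeal k n B ^ N) :
    φ b ∈ orderIdeal k n N := by
  rw [← Ideal.map_pow] at hb
  have h : ((MvPolynomial.idealOfVars (Fin n) k ^ N).map
      (algebraMap (MvPolynomial (Fin n) k) B)) ≤ (orderIdeal k n N).comap (φ : B →+* _) := by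
    rw [Ideal.map_le_iff_le_comap]
    intro p hp
    change φ (algebraMap _ B p) ∈ orderIdeal k n N
    rw [φ.commutes]
    intro d hd
    rw [coeff_algebraMap_mvPolynomial]
    exact (MvPolynomial.mem_pow_idealOfVars_iff' N p).mp hp d hd
  exact h hb

/-- In an unramified algebra with a section at the origin, the ideal of the section is generated by
the coordinates up to its own square. -/
theorem ker_evalZero_le [Algebra.FormallyUnramified (MvPolynomial (Fin n) k) B] :
    RingHom.ker (evalZero φ) ≤ varsIdeal k n B ⊔
      RingHom.ker (evalZero φ) • RingHom.ker (evalZero φ) := by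
  set κ := RingHom.ker (evalZero φ)
  set I := varsIdeal k n B
  let c : k →+* B := (algebraMap (MvPolynomial (Fin n) k) B).comp MvPolynomial.C
  have hc : ∀ b, b - c (evalZero φ b) ∈ κ := fun b => by
    rw [RingHom.mem_ker, map_sub]
    change _ - evalZero φ (algebraMap _ B (MvPolynomial.C _)) = 0
    rw [evalZero_algebraMap, MvPolynomial.constantCoeff_C, sub_self]
  let q := Ideal.Quotient.mk (I ⊔ κ • κ)
  -- Subtracting the value at the origin satisfies the Leibniz rule modulo `κ²` and kills
  -- polynomials modulo `I`; unramifiedness forces it to vanish.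
  let δ : B →+ B ⧸ (I ⊔ κ • κ) :=
    { toFun := fun b => q (b - c (evalZero φ b))
      map_zero' := by simp
      map_add' := fun x y => by rw [← map_add]; congr 1; simp only [map_add]; ring }
  have hδ : ∀ x y, δ (x * y) = q x * δ y + q y * δ x := by
    intro x y
    change q _ = q x * q _ + q y * q _
    rw [← map_mul, ← map_mul, ← map_add, Ideal.Quotient.eq]
    have h1 : (x - c (evalZero φ x)) * (y - c (evalZero φ y)) ∈ I ⊔ κ • κ :=
      Ideal.mem_sup_right (Ideal.mul_mem_mul (hc x) (hc y))
    convert neg_mem h1 using 1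
    simp only [map_mul]
    ring
  have h0 : ∀ a, δ (algebraMap (MvPolynomial (Fin n) k) B a) = 0 := by
    intro a
    refine Ideal.Quotient.eq_zero_iff_mem.mpr (Ideal.mem_sup_left ?_)
    rw [evalZero_algebraMap]
    change algebraMap _ B a - algebraMap _ B _ ∈ _
    rw [← map_sub]
    exact Ideal.mem_map_of_mem _ (sub_C_constantCoeff_mem a)
  intro b hb
  have := eq_zero_of_leibniz_of_formallyUnramified q δ hδ h0 b
  have h1 := Ideal.Quotient.eq_zero_iff_mem.mp this
  rw [RingHom.mem_ker] at hb
  rwa [hb, map_zero, sub_zero] at h1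

theorem exists_extension_away (h : B) (hh : IsUnit (φ h)) :
    ∃ ψ : Localization.Away h →ₐ[MvPolynomial (Fin n) k] MvPowerSeries (Fin n) k,
      ∀ b, ψ (algebraMap B _ b) = φ b := by
  have hu : ∀ y : Submonoid.powers h, IsUnit (φ y) := by
    rintro ⟨_, m, rfl⟩
    rw [map_pow]
    exact hh.pow m
  exact ⟨IsLocalization.liftAlgHom hu, fun b => by
    rw [IsLocalization.liftAlgHom_apply]
    exact IsLocalization.lift_eq _ _⟩

/-- If the coordinates generate the ideal of the section, `φ` detects powers of this ideal. -/
theorem exists_sub_algebraMap_mem (hφ : RingHom.ker (evalZero φ) ≤ varsIdeal k n B) (N : ℕ)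
    (b : B) : ∃ p : MvPolynomial (Fin n) k, b - algebraMap _ B p ∈ varsIdeal k n B ^ N := by
  have hstep : ∀ N, ∀ z ∈ varsIdeal k n B ^ N, ∃ p : MvPolynomial (Fin n) k,
      z - algebraMap _ B p ∈ varsIdeal k n B ^ (N + 1) := by
    intro N z hz
    have hz0 := hz
    rw [← Ideal.map_pow, Ideal.map] at hz
    suffices H : ∃ p ∈ MvPolynomial.idealOfVars (Fin n) k ^ N,
        z - algebraMap _ B p ∈ varsIdeal k n B ^ (N + 1) from H.imp fun p hp => hp.2
    clear hz0
    induction hz using Submodule.span_induction with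
    | mem x hx =>
      obtain ⟨p, hp, rfl⟩ := hx
      exact ⟨p, hp, by rw [sub_self]; exact zero_mem _⟩
    | zero => exact ⟨0, zero_mem _, by simp⟩
    | add x y _ _ hx hy =>
      obtain ⟨p, hp, hp'⟩ := hx
      obtain ⟨q, hq, hq'⟩ := hy
      refine ⟨p + q, add_mem hp hq, ?_⟩
      rw [map_add, add_sub_add_comm]
      exact add_mem hp' hq'
    | smul c x _ hx =>
      obtain ⟨p, hp, hp'⟩ := hx
      refine ⟨(MvPolynomial.C (evalZero φ c) : MvPolynomial (Fin n) k) * p, Ideal.mul_mem_left _ _ hp, ?_⟩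
      -- A scalar from `B` may be replaced by its value at the origin, at the cost of one more power
      -- of the coordinate ideal.
      have h1 : c - algebraMap (MvPolynomial (Fin n) k) B (MvPolynomial.C (evalZero φ c)) ∈ varsIdeal k n B := by
        refine hφ ?_
        rw [RingHom.mem_ker, map_sub, evalZero_algebraMap, MvPolynomial.constantCoeff_C, sub_self]
      have h2 : algebraMap _ B p ∈ varsIdeal k n B ^ N := by
        rw [← Ideal.map_pow]
        exact Ideal.mem_map_of_mem _ hp
      have h3 := add_mem (Ideal.mul_mem_left _ c hp') (pow_succ' (varsIdeal k n B) N ▸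
        Ideal.mul_mem_mul h1 h2)
      convert h3 using 1
      rw [smul_eq_mul, map_mul]
      ring
  induction N with
  | zero => exact ⟨0, by simp⟩
  | succ N ih =>
    obtain ⟨p, hp⟩ := ih
    obtain ⟨q, hq⟩ := hstep N _ hp
    exact ⟨p + q, by rwa [map_add, ← sub_sub]⟩

/-- Modulo the `N`-th power, `b` is a polynomial `p`. The order of `p` can be read off its image,
because `φ` is the canonical map on polynomials. -/
theorem mem_varsIdeal_pow_of_apply_mem (hφ : RingHom.ker (evalZero φ) ≤ varsIdeal k n B) {N : ℕ}
    {b : B} (hb : φ b ∈ orderIdeal k n N) : b ∈ varsIdeal k n B ^ N := by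
  obtain ⟨p, hp⟩ := exists_sub_algebraMap_mem φ hφ N b
  have h1 := apply_mem_orderIdeal φ hp
  rw [map_sub, φ.commutes] at h1
  have h2 : algebraMap _ (MvPowerSeries (Fin n) k) p ∈ orderIdeal k n N := by
    have := sub_mem hb h1
    rwa [sub_sub_cancel] at this
  have h3 : p ∈ MvPolynomial.idealOfVars (Fin n) k ^ N := by
    rw [MvPolynomial.mem_pow_idealOfVars_iff']
    intro d hd
    rw [← coeff_algebraMap_mvPolynomial]
    exact h2 d hd
  have h4 : algebraMap _ B p ∈ varsIdeal k n B ^ N := by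
    rw [← Ideal.map_pow]
    exact Ideal.mem_map_of_mem _ h3
  have := add_mem hp h4
  rwa [sub_add_cancel] at this

end

/-- Finitely many algebraic power series lie in the image of one étale algebra over the polynomial
ring. -/
theorem exists_etale_of_finset (s : Finset (MvPowerSeries (Fin n) k))
    (hs : ∀ g ∈ s, IsAlgebraicSeries g) :
    ∃ (B : Type u) (_ : CommRing B) (_ : Algebra (MvPolynomial (Fin n) k) B)
      (_ : Algebra.Etale (MvPolynomial (Fin n) k) B)
      (φ : B →ₐ[MvPolynomial (Fin n) k] MvPowerSeries (Fin n) k),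
      ∀ g ∈ s, ∃ b, φ b = g := by
  classical
  induction s using Finset.induction_on with
  | empty =>
    exact ⟨MvPolynomial (Fin n) k, inferInstance, inferInstance, inferInstance,
      Algebra.ofId _ _, by simp⟩
  | insert g s _ ih =>
    obtain ⟨B, _, _, _, φ, hφ⟩ := ih fun g hg => hs g (Finset.mem_insert_of_mem hg)
    obtain ⟨B', _, _, _, φ', b', hb'⟩ := hs g (Finset.mem_insert_self g s)
    refine ⟨B ⊗[MvPolynomial (Fin n) k] B', inferInstance, inferInstance,
      Algebra.Etale.comp _ B _, Algebra.TensorProduct.productMap φ φ', fun f hf => ?_⟩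
    obtain rfl | hf := Finset.mem_insert.mp hf
    · exact ⟨1 ⊗ₜ b', by simpa using hb'⟩
    · obtain ⟨b, hb⟩ := hφ f hf
      exact ⟨b ⊗ₜ 1, by simpa using hb⟩

/-- Finitely many algebraic power series lie in the image of one étale algebra over the polynomial
ring in which the coordinates generate the ideal of the origin. -/
theorem exists_etale_of_finset_of_ker_le [IsNoetherianRing k]
    (s : Finset (MvPowerSeries (Fin n) k)) (hs : ∀ g ∈ s, IsAlgebraicSeries g) :
    ∃ (B : Type u) (_ : CommRing B) (_ : Algebra (MvPolynomial (Fin n) k) B)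
      (_ : Algebra.Etale (MvPolynomial (Fin n) k) B)
      (φ : B →ₐ[MvPolynomial (Fin n) k] MvPowerSeries (Fin n) k),
      RingHom.ker (evalZero φ) ≤ varsIdeal k n B ∧ ∀ g ∈ s, ∃ b, φ b = g := by
  obtain ⟨B, _, _, _, φ, hφ⟩ := exists_etale_of_finset s hs
  have : IsNoetherianRing B := Algebra.FiniteType.isNoetherianRing (MvPolynomial (Fin n) k) B
  -- Nakayama's lemma gives `h` with value `1` at the origin that carries the ideal of the section
  -- into the coordinate ideal; inverting `h` shrinks the chart suitably.
  obtain ⟨h, h1, h2⟩ := Submodule.exists_sub_one_mem_and_smul_le_of_fg_of_le_sup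
    (IsNoetherian.noetherian (RingHom.ker (evalZero φ))) le_rfl (ker_evalZero_le φ)
  have hh : IsUnit (φ h) := by
    rw [MvPowerSeries.isUnit_iff_constantCoeff]
    rw [RingHom.mem_ker, map_sub, map_one, sub_eq_zero] at h1
    change IsUnit (evalZero φ h)
    rw [h1]
    exact isUnit_one
  obtain ⟨ψ, hψ⟩ := exists_extension_away φ h hh
  have : Algebra.Etale B (Localization.Away h) := .of_isLocalizationAway h
  refine ⟨Localization.Away h, inferInstance, inferInstance,
    Algebra.Etale.comp (MvPolynomial (Fin n) k) B _, ψ, fun z hz => ?_, fun g hg => ?_⟩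
  · obtain ⟨m, b, hzb⟩ := IsLocalization.Away.surj h z
    have hunit : IsUnit (algebraMap B (Localization.Away h) h) :=
      IsLocalization.Away.algebraMap_isUnit h
    have hb : b ∈ RingHom.ker (evalZero φ) := by
      have h3 := Ideal.mul_mem_right (algebraMap B (Localization.Away h) h ^ m) _ hz
      rw [hzb] at h3
      change MvPowerSeries.constantCoeff (ψ (algebraMap B _ b)) = 0 at h3
      rwa [hψ] at h3
    have h3 : h * b ∈ varsIdeal k n B := h2 (Submodule.smul_mem_pointwise_smul _ _ _ hb)
    have h4 : algebraMap B (Localization.Away h) (h * b) ∈ varsIdeal k n (Localization.Away h) := by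
      have := Ideal.mem_map_of_mem (algebraMap B (Localization.Away h)) h3
      rwa [Ideal.map_map, ← IsScalarTower.algebraMap_eq] at this
    rw [map_mul, ← hzb] at h4
    exact (Ideal.mul_unit_mem_iff_mem _ (hunit.pow m)).mp
      ((Ideal.unit_mul_mem_iff_mem _ hunit).mp h4)
  · obtain ⟨b, hb⟩ := hφ g hg
    exact ⟨algebraMap B _ b, (hψ b).trans hb⟩

/-- The formal inverse is algebraic, because inverting `b` in its étale chart gives another étale
chart. -/
theorem isUnit_algebraicSeries {g : algebraicSeries k n}
    (hg : IsUnit (MvPowerSeries.constantCoeff g.1)) : IsUnit g := by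
  have hg' : IsUnit g.1 := MvPowerSeries.isUnit_iff_constantCoeff.mpr hg
  obtain ⟨g, B, _, _, _, φ, b, rfl⟩ := g
  obtain ⟨ψ, hψ⟩ := exists_extension_away φ b hg'
  have : Algebra.Etale B (Localization.Away b) := .of_isLocalizationAway b
  obtain ⟨c, hc⟩ := isUnit_iff_exists_inv.mp (IsLocalization.Away.algebraMap_isUnit (S := Localization.Away b) b)
  refine IsUnit.of_mul_eq_one ⟨ψ c, Localization.Away b, inferInstance, inferInstance,
    Algebra.Etale.comp (MvPolynomial (Fin n) k) B _, ψ, c, rfl⟩ (Subtype.ext ?_)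
  change φ b * ψ c = 1
  rw [← hψ, ← map_mul, hc, map_one]

instance isLocalRing_algebraicSeries [IsLocalRing k] : IsLocalRing (algebraicSeries k n) := by
  let ε : algebraicSeries k n →+* k :=
    MvPowerSeries.constantCoeff.comp (algebraicSeries k n).val.toRingHom
  have : IsLocalHom ε := ⟨fun g hg => isUnit_algebraicSeries hg⟩
  exact RingHom.domain_isLocalRing ε

/-- Elements of `J` generating its extension to formal series already generate `J`: membership with
formal coefficients holds to every order in an étale chart, and Krull's theorem makes it exact up to
a factor that becomes a unit. -/
instance isNoetherianRing_algebraicSeries [IsNoetherianRing k] :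
    IsNoetherianRing (algebraicSeries k n) := by
  classical
  refine ⟨fun J => ?_⟩
  let val := (algebraicSeries k n).val.toRingHom
  have hfg : (Submodule.span (MvPowerSeries (Fin n) k) (val '' J)).FG :=
    IsNoetherian.noetherian _
  obtain ⟨s', hs', hspan⟩ := (Submodule.fg_span_iff_fg_span_finset_subset _).mp hfg
  obtain ⟨s, hsJ, rfl⟩ := Finset.subset_set_image_iff.mp hs'
  refine ⟨s, le_antisymm (Submodule.span_le.mpr hsJ) fun h hh => ?_⟩
  obtain ⟨B, _, _, _, φ, hφ, hB⟩ := exists_etale_of_finset_of_ker_le (insert h.1 (s.image val))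
    fun g hg => by
      obtain rfl | hg := Finset.mem_insert.mp hg
      · exact h.2
      · obtain ⟨g, _, rfl⟩ := Finset.mem_image.mp hg
        exact g.2
  have : IsNoetherianRing B := Algebra.FiniteType.isNoetherianRing (MvPolynomial (Fin n) k) B
  obtain ⟨b, hb⟩ := hB h.1 (Finset.mem_insert_self _ _)
  have hlift : ∀ g : s, ∃ b, φ b = g.1.1 := fun g =>
    hB _ (Finset.mem_insert_of_mem (Finset.mem_image_of_mem val g.2))
  choose β hβ using hlift
  let 𝔟 : Ideal B := Ideal.span (Set.range β)
  have hmem : h.1 ∈ Submodule.span (MvPowerSeries (Fin n) k) (val '' J) :=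
    Submodule.subset_span ⟨h, hh, rfl⟩
  rw [hspan] at hmem
  have hmem' : h.1 ∈ Submodule.span (MvPowerSeries (Fin n) k) (Set.range fun g : s => g.1.1) := by
    convert hmem using 2
    ext x
    simp [val]
  obtain ⟨c, hc⟩ := (Submodule.mem_span_range_iff_exists_fun _).mp hmem'
  -- Truncating the formal coefficients `c` gives polynomial ones, with an error of order at least
  -- `N`.
  have happrox : ∀ N, b ∈ 𝔟 ⊔ varsIdeal k n B ^ N := by
    intro N
    have h1 : φ (b - ∑ g, algebraMap _ B (MvPowerSeries.truncTotal N (c g)) * β g) ∈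
        orderIdeal k n N := by
      rw [map_sub, hb, ← hc, map_sum, ← Finset.sum_sub_distrib]
      refine sum_mem fun g _ => ?_
      rw [map_mul, hβ, φ.commutes, smul_eq_mul, ← sub_mul]
      refine Ideal.mul_mem_right _ _ fun d hd => ?_
      rw [map_sub, coeff_algebraMap_mvPolynomial, MvPowerSeries.coeff_truncTotal _ hd, sub_self]
    have h2 := mem_varsIdeal_pow_of_apply_mem φ hφ h1
    have h3 : ∑ g, algebraMap _ B (MvPowerSeries.truncTotal N (c g)) * β g ∈ 𝔟 :=
      sum_mem fun g _ => Ideal.mul_mem_left _ _ (Ideal.subset_span (Set.mem_range_self g))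
    have := add_mem (Ideal.mem_sup_left (T := varsIdeal k n B ^ N) h3) (Ideal.mem_sup_right h2)
    rwa [add_sub_cancel] at this
  have hKrull : (Submodule.Quotient.mk b : B ⧸ 𝔟) ∈
      (⨅ i : ℕ, varsIdeal k n B ^ i • ⊤ : Submodule B (B ⧸ 𝔟)) := by
    refine (Submodule.mem_iInf _).mpr fun N => ?_
    obtain ⟨x, hx, y, hy, hxy⟩ := Submodule.mem_sup.mp (happrox N)
    have h1 : (Submodule.Quotient.mk b : B ⧸ 𝔟) = y • Submodule.Quotient.mk 1 := by
      rw [← Submodule.Quotient.mk_smul, smul_eq_mul, mul_one, Submodule.Quotient.eq, ← hxy,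
        add_sub_cancel_right]
      exact hx
    rw [h1]
    exact Submodule.smul_mem_smul hy trivial
  -- Krull's theorem in this form needs no local ring: the class of `b` is fixed by some `r` in the
  -- coordinate ideal. Then `1 - r` has value `1` at the origin.
  obtain ⟨r, hr⟩ := (Ideal.mem_iInf_smul_pow_eq_bot_iff _ _).mp hKrull
  have hr' : (1 - r.1) * b ∈ 𝔟 := by
    rw [← Submodule.Quotient.mk_smul, Submodule.Quotient.eq] at hr
    have := neg_mem hr
    rw [smul_eq_mul] at this
    convert this using 1
    ring
  obtain ⟨a, ha⟩ := (Submodule.mem_span_range_iff_exists_fun _).mp hr'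
  let Φ : B → algebraicSeries k n := fun b => ⟨φ b, B, _, _, ‹_›, φ, b, rfl⟩
  have hunit : IsUnit (Φ (1 - r.1)) := by
    refine isUnit_algebraicSeries ?_
    have h1 := apply_mem_orderIdeal φ (N := 1) (by rw [pow_one]; exact r.2) 0 (by simp)
    change IsUnit (MvPowerSeries.constantCoeff (φ (1 - r.1)))
    rw [map_sub, map_sub, map_one, map_one, ← MvPowerSeries.coeff_zero_eq_constantCoeff_apply, h1,
      sub_zero]
    exact isUnit_one
  have hprod : Φ (1 - r.1) * h = ∑ g, Φ (a g) * g.1 := by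
    refine Subtype.ext ?_
    rw [Subalgebra.coe_mul, AddSubmonoidClass.coe_finsetSum]
    change φ (1 - r.1) * h.1 = ∑ g : s, φ (a g) * g.1.1
    rw [← hb, ← map_mul, ← ha, map_sum]
    refine Finset.sum_congr rfl fun g _ => ?_
    rw [smul_eq_mul, map_mul, hβ]
  refine (Submodule.smul_mem_iff_of_isUnit _ hunit).mp ?_
  rw [smul_eq_mul, hprod]
  exact sum_mem fun g _ => Submodule.smul_mem _ _ (Submodule.subset_span g.2)

end charts

end Germ

/-! ### The required properties of the four systems of power series. -/

namespace Germ

section hadamard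

open MvPowerSeries

/-- Every power series is `g(0) + ∑ xᵢ gᵢ`, where the coefficients of each `gᵢ` are among those
of `g`. -/
theorem exists_eq_C_add_sum_X_mul {k : Type*} [CommRing k] {n : ℕ} (g : MvPowerSeries (Fin n) k) :
    ∃ G : Fin n → MvPowerSeries (Fin n) k, g = C (constantCoeff g) + ∑ i, X i * G i ∧
      ∀ i e, coeff e (G i) = 0 ∨ coeff e (G i) = coeff (e + Finsupp.single i 1) g := by
  classical
  -- Each nonconstant monomial is assigned to one variable dividing it, so that it is counted in
  -- exactly one `X i * G i`.
  obtain ⟨sel, hsel, hsel0⟩ : ∃ sel : (Fin n →₀ ℕ) → Option (Fin n),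
      (∀ d i, sel d = some i → Finsupp.single i 1 ≤ d) ∧ ∀ d, sel d = none ↔ d = 0 := by
    refine ⟨fun d => if H : ∃ i, d i ≠ 0 then some H.choose else none, fun d i hd => ?_,
      fun d => ?_⟩
    · dsimp only at hd
      split_ifs at hd with H
      rw [← Option.some.inj hd, Finsupp.single_le_iff]
      exact Nat.one_le_iff_ne_zero.mpr H.choose_spec
    · dsimp only
      split_ifs with H
      · simp only [false_iff]
        rintro rfl
        exact H.choose_spec rfl
      · simp only [true_iff]
        ext i
        by_contra hi
        exact H ⟨i, hi⟩
  let G : Fin n → MvPowerSeries (Fin n) k := fun i e =>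
    if sel (e + Finsupp.single i 1) = some i then coeff (e + Finsupp.single i 1) g else 0
  have hG : ∀ i e, coeff e (G i) =
    if sel (e + Finsupp.single i 1) = some i then coeff (e + Finsupp.single i 1) g else 0 :=
    fun _ _ => rfl
  refine ⟨G, ?_, fun i e => ?_⟩
  · ext d
    rw [map_add, map_sum, coeff_C]
    have h1 : ∀ i, coeff d (X i * G i) = if sel d = some i then coeff d g else 0 := by
      intro i
      rw [X_def, coeff_monomial_mul]
      by_cases hi : Finsupp.single i 1 ≤ d
      · rw [if_pos hi, one_mul, hG, tsub_add_cancel_of_le hi]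
      · rw [if_neg hi, if_neg fun H => hi (hsel d i H)]
    simp_rw [h1]
    cases hd : sel d with
    | none =>
      obtain rfl := (hsel0 d).mp hd
      simp
    | some i =>
      have hd0 : d ≠ 0 := fun h0 => by rw [(hsel0 d).mpr h0] at hd; cases hd
      simp [hd0]
  · rw [hG]
    split_ifs
    · exact Or.inr rfl
    · exact Or.inl rfl

end hadamard

namespace SeriesSystem

variable {k : Type u} [CommRing k]

/-- The properties of a system of power series rings on which the comparison of critical loci
relies. -/
structure IsRegular (S : SeriesSystem k) : Prop where
  isNoetherianRing (n : ℕ) : IsNoetherianRing (S.ring n)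
  isLocalRing (n : ℕ) : IsLocalRing (S.ring n)
  X_mem {n : ℕ} (i : Fin n) : MvPowerSeries.X i ∈ S.ring n
  pderiv_mem {n : ℕ} (i : Fin n) (g : MvPowerSeries (Fin n) k) (hg : g ∈ S.ring n) :
    MvPowerSeries.pderiv k i g ∈ S.ring n
  eq_zero_of_leibniz {n : ℕ} {C : Type u} [CommRing C] [Algebra k C] [IsLocalRing C]
    [IsNoetherianRing C] (φ : S.ring n →ₐ[k] C)
    (hφ : ∀ x : S.ring n, (∃ i, x.1 = MvPowerSeries.X i) → φ x ∈ IsLocalRing.maximalIdeal C)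
    (δ : S.ring n →ₗ[k] C)
    (hδ : ∀ x y, δ (x * y) = φ x * δ y + φ y * δ x)
    (h0 : ∀ x : S.ring n, (∃ i, x.1 = MvPowerSeries.X i) → δ x = 0) (g : S.ring n) : δ g = 0

theorem leibniz_algebraMap {k A C : Type*} [CommRing k] [CommRing A] [CommRing C] [Algebra k A]
    [Algebra k C] {φ : A →ₐ[k] C} {δ : A →ₗ[k] C}
    (hδ : ∀ x y, δ (x * y) = φ x * δ y + φ y * δ x) (a : k) : δ (algebraMap k A a) = 0 := by
  have h1 : δ 1 = 0 := by
    have := hδ 1 1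
    rw [mul_one, map_one φ, one_mul] at this
    simpa using this
  rw [Algebra.algebraMap_eq_smul_one, map_smul, h1, smul_zero]

/-- If the rings are closed under dividing by a coordinate, then series lie in the ideal of the
coordinates up to constants, and maps satisfying the Leibniz rule are determined by their values on
the coordinates. -/
theorem eq_zero_of_leibniz_of_shift (S : SeriesSystem k) {n : ℕ}
    (hX : ∀ i : Fin n, MvPowerSeries.X i ∈ S.ring n)
    (hshift : ∀ (i : Fin n) (g G : MvPowerSeries (Fin n) k), g ∈ S.ring n →
      (∀ e, MvPowerSeries.coeff e G = 0 ∨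
        MvPowerSeries.coeff e G = MvPowerSeries.coeff (e + Finsupp.single i 1) g) → G ∈ S.ring n)
    {C : Type u} [CommRing C] [Algebra k C] [IsLocalRing C]
    [IsNoetherianRing C] (φ : S.ring n →ₐ[k] C)
    (hφ : ∀ x : S.ring n, (∃ i, x.1 = MvPowerSeries.X i) → φ x ∈ IsLocalRing.maximalIdeal C)
    (δ : S.ring n →ₗ[k] C)
    (hδ : ∀ x y, δ (x * y) = φ x * δ y + φ y * δ x)
    (h0 : ∀ x : S.ring n, (∃ i, x.1 = MvPowerSeries.X i) → δ x = 0) (g : S.ring n) : δ g = 0 := by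
  -- Each use of `g = g(0) + ∑ xᵢ Gᵢ` gives `δ g = ∑ φ(xᵢ) δ(Gᵢ)` and so gains one power of the
  -- maximal ideal; Krull's theorem finishes.
  have key : ∀ N, ∀ g : S.ring n, δ g ∈ (Ideal.jacobson (⊥ : Ideal C)) ^ N := by
    intro N
    induction N with
    | zero => intro g; simp
    | succ N ih =>
      intro g
      obtain ⟨G, hG, hGc⟩ := exists_eq_C_add_sum_X_mul g.1
      have hmem : ∀ i, G i ∈ S.ring n := fun i => hshift i g.1 (G i) g.2 (hGc i)
      have hg : g = algebraMap k _ (MvPowerSeries.constantCoeff g.1) +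
          ∑ i, (⟨_, hX i⟩ : S.ring n) * ⟨G i, hmem i⟩ := by
        refine Subtype.ext ?_
        rw [Subalgebra.coe_add, AddSubmonoidClass.coe_finsetSum]
        exact hG
      rw [hg, map_add, leibniz_algebraMap hδ, zero_add, map_sum]
      refine sum_mem fun i _ => ?_
      rw [hδ, h0 ⟨_, hX i⟩ ⟨i, rfl⟩, mul_zero, add_zero, pow_succ']
      refine Ideal.mul_mem_mul ?_ (ih _)
      rw [IsLocalRing.jacobson_eq_maximalIdeal _ bot_ne_top]
      exact hφ _ ⟨i, rfl⟩
  rw [← Ideal.mem_bot, ← iInf_jacobson_pow_eq_bot C, Submodule.mem_iInf]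
  exact fun N => key N g

theorem isRegular_formalSystem [IsLocalRing k] [IsNoetherianRing k] :
    (formalSystem k).IsRegular where
  isNoetherianRing n := isNoetherianRing_of_ringEquiv (MvPowerSeries (Fin n) k)
    (Subalgebra.topEquiv (R := k)).symm.toRingEquiv
  isLocalRing n := RingEquiv.isLocalRing
    (Subalgebra.topEquiv (R := k) (A := MvPowerSeries (Fin n) k)).symm.toRingEquiv
  X_mem _ := Algebra.mem_top
  pderiv_mem _ _ _ := Algebra.mem_top
  eq_zero_of_leibniz := eq_zero_of_leibniz_of_shift _ (fun _ => Algebra.mem_top)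
    fun _ _ _ _ _ => Algebra.mem_top

theorem isRegular_analyticSystem (K : Type u) [NormedField K] :
    (analyticSystem K).IsRegular where
  isNoetherianRing n := isNoetherianRing_convergentSeries
  isLocalRing n := isLocalRing_convergentSeries
  X_mem i := isConvergent_monomial _
  pderiv_mem {n} i g hg := by
    obtain ⟨C, ρ, hC, hρ, h⟩ := hg
    refine ⟨C * ρ, 2 * ρ, by positivity, by linarith, fun d => ?_⟩
    rw [MvPowerSeries.coeff_pderiv, norm_mul]
    -- The factor produced by differentiation is at most geometric in the degree, which explains the
    -- doubled rate `2 * ρ`.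
    have h1 : ‖((d i : K) + 1)‖ ≤ 2 ^ d.degree := by
      have h2 : ‖((d i + 1 : ℕ) : K)‖ ≤ (d i + 1 : ℕ) := by
        simpa using Nat.norm_cast_le (α := K) (d i + 1)
      have h3 : d i + 1 ≤ 2 ^ d.degree :=
        (Nat.lt_two_pow_self (n := d i)).trans_le
          (Nat.pow_le_pow_right two_pos (Finsupp.le_degree i d))
      push_cast at h2
      refine h2.trans ?_
      exact_mod_cast h3
    calc _ ≤ (C * ρ ^ (d + Finsupp.single i 1).degree) * 2 ^ d.degree := by
          gcongr
          exact h _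
      _ = _ := by
          rw [map_add, Finsupp.degree_single, pow_succ, mul_pow]
          ring
  eq_zero_of_leibniz {n} := eq_zero_of_leibniz_of_shift (analyticSystem K)
    (fun i => isConvergent_monomial (Finsupp.single i 1)) (by
    rintro i g G ⟨C, ρ, hC, hρ, h⟩ hG
    refine ⟨C * ρ, ρ, by positivity, hρ, fun d => ?_⟩
    obtain h0 | h0 := hG d
    · rw [h0, norm_zero]
      positivity
    · rw [h0]
      refine (h _).trans (le_of_eq ?_)
      rw [map_add, Finsupp.degree_single, pow_succ]
      ring)

open MvPowerSeries in
theorem isRegular_relativeAnalyticSystem (K : Type u) [NormedField K] (s : ℕ) :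
    (relativeAnalyticSystem K s).IsRegular := by
  classical
  have hX : ∀ {n : ℕ} (i : Fin n), X i ∈ jointlyConvergentSeries K s n := by
    intro n i
    refine ⟨1, 1, zero_le_one, le_rfl, fun d e => ?_⟩
    rw [coeff_X]
    split_ifs
    · rw [Subalgebra.coe_one, coeff_one]
      split_ifs <;> simp
    · rw [Subalgebra.coe_zero, map_zero, norm_zero]
      positivity
  exact
  { isNoetherianRing n := isNoetherianRing_jointlyConvergentSeries
    isLocalRing n := isLocalRing_jointlyConvergentSeries
    X_mem := hX
    pderiv_mem := by
      rintro n i g ⟨C, ρ, hC, hρ, h⟩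
      refine ⟨C * ρ, 2 * ρ, by positivity, by linarith, fun d e => ?_⟩
      rw [coeff_pderiv]
      have h4 : ((coeff (d + Finsupp.single i 1) g * ((d i : convergentSeries K s) + 1))).1 =
          ((d i : K) + 1) • (coeff (d + Finsupp.single i 1) g).1 := by
        rw [Subalgebra.coe_mul, mul_comm, Algebra.smul_def]
        congr 1
        simp
      rw [h4, coeff_smul, norm_mul]
      have h1 : ‖((d i : K) + 1)‖ ≤ 2 ^ d.degree := by
        have h2 : ‖((d i + 1 : ℕ) : K)‖ ≤ (d i + 1 : ℕ) := by
          simpa using Nat.norm_cast_le (α := K) (d i + 1)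
        have h3 : d i + 1 ≤ 2 ^ d.degree :=
          (Nat.lt_two_pow_self (n := d i)).trans_le
            (Nat.pow_le_pow_right two_pos (Finsupp.le_degree i d))
        push_cast at h2
        refine h2.trans ?_
        exact_mod_cast h3
      calc _ ≤ 2 ^ d.degree * (C * ρ ^ ((d + Finsupp.single i 1).degree + e.degree)) := by
            gcongr
            exact h _ _
        _ ≤ 2 ^ (d.degree + e.degree) *
            (C * ρ ^ ((d + Finsupp.single i 1).degree + e.degree)) := by
            gcongr
            · exact one_le_two
            · exact Nat.le_add_right _ _
        _ = _ := by
            rw [map_add, Finsupp.degree_single, mul_pow]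
            ring
    eq_zero_of_leibniz := eq_zero_of_leibniz_of_shift _ hX (by
      rintro i g G ⟨C, ρ, hC, hρ, h⟩ hG
      refine ⟨C * ρ, ρ, by positivity, hρ, fun d e => ?_⟩
      obtain h0 | h0 := hG d
      · rw [h0, Subalgebra.coe_zero, map_zero, norm_zero]
        positivity
      · rw [h0]
        refine (h _ _).trans (le_of_eq ?_)
        rw [map_add, Finsupp.degree_single]
        ring) }

theorem isAlgebraicSeries_algebraMap {n : ℕ} (p : MvPolynomial (Fin n) k) :
    IsAlgebraicSeries (algebraMap _ (MvPowerSeries (Fin n) k) p) :=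
  ⟨MvPolynomial (Fin n) k, inferInstance, inferInstance, inferInstance, Algebra.ofId _ _, p, rfl⟩

theorem algebraMap_mvPolynomial_X {n : ℕ} (i : Fin n) :
    algebraMap (MvPolynomial (Fin n) k) (MvPowerSeries (Fin n) k) (MvPolynomial.X i) = MvPowerSeries.X i := by
  rw [MvPowerSeries.algebraMap_apply']
  simp

/-- The derivation `∂ᵢ` of the polynomial ring extends to the étale chart. Its image under `φ` and
the formal derivative agree on polynomials, hence everywhere, by unramifiedness. -/
theorem IsAlgebraicSeries.pderiv {n : ℕ} (i : Fin n) {g : MvPowerSeries (Fin n) k}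
    (hg : IsAlgebraicSeries g) : IsAlgebraicSeries (MvPowerSeries.pderiv k i g) := by
  obtain ⟨B, _, _, _, φ, b, rfl⟩ := hg
  let : Algebra k B := ((algebraMap (MvPolynomial (Fin n) k) B).comp MvPolynomial.C).toAlgebra
  have : IsScalarTower k (MvPolynomial (Fin n) k) B := .of_algebraMap_eq fun _ => rfl
  obtain ⟨E, hE⟩ := Derivation.exists_extension_of_formallyEtale (T := B)
    (MvPolynomial.pderiv i : Derivation k (MvPolynomial (Fin n) k) _)
  refine ⟨B, _, _, ‹_›, φ, E b, ?_⟩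
  let δ : B →+ MvPowerSeries (Fin n) k :=
    { toFun := fun b => φ (E b) - MvPowerSeries.pderiv k i (φ b)
      map_zero' := by simp
      map_add' := fun x y => by simp only [map_add]; ring }
  refine sub_eq_zero.mp (eq_zero_of_leibniz_of_formallyUnramified (A := MvPolynomial (Fin n) k)
    (φ : B →+* _) δ (fun x y => ?_) (fun p => ?_) b)
  · change φ (E (x * y)) - MvPowerSeries.pderiv k i (φ (x * y)) =
      φ x * (φ (E y) - MvPowerSeries.pderiv k i (φ y)) +
      φ y * (φ (E x) - MvPowerSeries.pderiv k i (φ x))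
    simp only [Derivation.leibniz, map_mul, map_add, smul_eq_mul]
    ring
  · change φ (E (algebraMap _ B p)) - MvPowerSeries.pderiv k i (φ (algebraMap _ B p)) = 0
    rw [hE, φ.commutes, φ.commutes, sub_eq_zero, MvPowerSeries.algebraMap_apply',
      MvPowerSeries.algebraMap_apply']
    simp [MvPowerSeries.pderiv_coe]

theorem isRegular_algebraicSystem [IsLocalRing k] [IsNoetherianRing k] :
    (algebraicSystem k).IsRegular where
  isNoetherianRing n := isNoetherianRing_algebraicSeries
  isLocalRing n := isLocalRing_algebraicSeries
  X_mem i := algebraMap_mvPolynomial_X (k := k) i ▸ isAlgebraicSeries_algebraMap _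
  pderiv_mem i g hg := IsAlgebraicSeries.pderiv i hg
  eq_zero_of_leibniz := by
    rintro n C _ _ _ _ φ - δ hδ h0 ⟨g, B, _, _, _, ψ, b, rfl⟩
    -- Here unramifiedness replaces Krull's theorem: pulled back to the chart, `δ` vanishes on
    -- polynomials and therefore on all of `B`.
    let Ψ : B →+* (algebraicSystem k).ring n :=
      (ψ : B →+* MvPowerSeries (Fin n) k).codRestrict ((algebraicSystem k).ring n)
        fun b => ⟨B, _, _, ‹_›, ψ, b, rfl⟩
    refine eq_zero_of_leibniz_of_formallyUnramified (A := MvPolynomial (Fin n) k)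
      ((φ : _ →+* C).comp Ψ) (δ.toAddMonoidHom.comp Ψ.toAddMonoidHom) (fun x y => ?_) (fun p => ?_) b
    · change δ (Ψ (x * y)) = φ (Ψ x) * δ (Ψ y) + φ (Ψ y) * δ (Ψ x)
      rw [map_mul, hδ]
    · change δ (Ψ (algebraMap _ B p)) = 0
      induction p using MvPolynomial.induction_on with
      | C a =>
        rw [← leibniz_algebraMap hδ a]
        congr 1
        refine Subtype.ext ?_
        change ψ (algebraMap _ B (MvPolynomial.C a)) = algebraMap k (MvPowerSeries (Fin n) k) a
        rw [ψ.commutes, MvPowerSeries.algebraMap_apply']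
        simp [MvPowerSeries.algebraMap_apply]
      | add p q hp hq => rw [map_add, map_add, map_add, hp, hq, add_zero]
      | mul_X p i hp =>
        rw [map_mul, map_mul, hδ, hp, mul_zero, add_zero, h0, mul_zero]
        refine ⟨i, ?_⟩
        change ψ (algebraMap _ B (MvPolynomial.X i)) = _
        rw [ψ.commutes, algebraMap_mvPolynomial_X]

theorem IsGermSystem.isRegular {S : SeriesSystem k} (hS : S.IsGermSystem) : S.IsRegular := by
  cases hS with
  | formal => exact isRegular_formalSystem
  | algebraic => exact isRegular_algebraicSystem
  | analytic => exact isRegular_analyticSystem _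
  | relativeAnalytic => exact isRegular_relativeAnalyticSystem _ _

end SeriesSystem

end Germ

/-! ### Finite coverings and maps determined by coordinates. -/

namespace Germ

section covering

variable {k A B C : Type*} [CommRing k] [CommRing A] [CommRing B] [CommRing C]
  [Algebra k A] [Algebra k B] [Algebra k C]

theorem IsFiniteCovering.isLocalHom {π : A →+* B} (hπ : IsFiniteCovering A B π) : IsLocalHom π :=
  (RingHom.IsIntegral.of_finite hπ.finite).isLocalHom hπ.surjective

/-- Maps along `φ` satisfying the Leibniz rule are determined by their values on the family `x`. -/
def LeibnizDetermined (φ : A →ₐ[k] B) {ι : Type*} (x : ι → A) : Prop :=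
  ∀ δ : A →ₗ[k] B, (∀ a b, δ (a * b) = φ a * δ b + φ b * δ a) → (∀ i, δ (x i) = 0) → ∀ a, δ a = 0

theorem LeibnizDetermined.eq_zero [IsLocalRing A] [IsLocalRing B] {φ : A →ₐ[k] B} {ι : Type*}
    {x : ι → A} (hx : LeibnizDetermined φ x) (h : TangentModule φ)
    (h0 : ∀ i, h (sepD k A (x i)) = 0) : h = 0 :=
  TangentModule.ext_sepD (hx h.toLinearMap h.apply_sepD_mul h0)

theorem isLocalHom_of_surjective [IsLocalRing A] [Nontrivial B] {q : A →ₐ[k] B}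
    (hq : Function.Surjective q) : IsLocalHom q :=
  have : IsLocalHom (q : A →+* B) := IsLocalHom.of_surjective _ hq
  ⟨this.map_nonunit⟩

theorem isLocalHom_algHom_comp {f : B →ₐ[k] C} {g : A →ₐ[k] B} (hf : IsLocalHom f)
    (hg : IsLocalHom g) : IsLocalHom (f.comp g) :=
  ⟨fun a ha => hg.map_nonunit a (hf.map_nonunit (g a) ha)⟩

theorem LeibnizDetermined.of_surjective {φ : B →ₐ[k] C} {q : A →ₐ[k] B}
    (hq : Function.Surjective q) {ι : Type*} {x : ι → A}
    (hx : LeibnizDetermined (φ.comp q) x) : LeibnizDetermined φ fun i => q (x i) := by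
  intro δ hδ h0 b
  obtain ⟨a, rfl⟩ := hq b
  refine hx (δ.comp q.toLinearMap) (fun a b => ?_) h0 a
  change δ (q (a * b)) = _
  rw [map_mul]
  exact hδ _ _

/-- A finite covering by a germ does not change the critical locus, provided that no component of
either critical locus lies over the ramification locus. -/
theorem IsFiniteCovering.critLocus_comp_eq [IsLocalRing A] [IsLocalRing B] [IsLocalRing C]
    [IsNoetherianRing A] [IsNoetherianRing C] {π : A →ₐ[k] B}
    (hπ : IsFiniteCovering A B π.toRingHom) (f : B →ₐ[k] C) (hf : IsLocalHom f)
    {ι κ : Type*} [Fintype ι] [Finite κ] {x : ι → A} (hx : LeibnizDetermined (f.comp π) x)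
    {y : κ → B} (hy : LeibnizDetermined f y)
    (D : ι → Derivation k A A) (hDx : ∀ i, D i (x i) = 1) (hDx' : ∀ i j, i ≠ j → D i (x j) = 0)
    (hcrit : ∀ Z, IsIrreducibleComponentOf Z (critLocus k B C f) →
      ¬ Z ⊆ PrimeSpectrum.comap f.toRingHom ⁻¹' ramLocus A B π.toRingHom)
    (hcrit' : ∀ Z, IsIrreducibleComponentOf Z (critLocus k A C (f.comp π)) →
      ¬ Z ⊆ PrimeSpectrum.comap f.toRingHom ⁻¹' ramLocus A B π.toRingHom) :
    critLocus k B C f = critLocus k A C (f.comp π) := by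
  have : IsLocalHom (f : B →+* C) := ⟨fun a ha => hf.map_nonunit a ha⟩
  exact eq_of_irreducible_components_not_subset (PrimeSpectrum.isClosed_zeroLocus _)
    (PrimeSpectrum.isClosed_zeroLocus _)
    ((PrimeSpectrum.isClosed_zeroLocus _).preimage (PrimeSpectrum.continuous_comap _))
    hcrit hcrit' fun p hp =>
      hπ.mem_critLocus_comp_iff f x hx.eq_zero y hy.eq_zero D hDx hDx' p hp

end covering

end Germ

/-! ### Coordinates on germs and the theorem. -/

namespace Germ.SeriesSystem

variable {k : Type u} [CommRing k] {S : SeriesSystem k}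

/-- The coordinate functions of the ambient space of a germ. -/
def IsRegular.coord (hR : S.IsRegular) {n : ℕ} (i : Fin n) : S.ring n :=
  ⟨MvPowerSeries.X i, hR.X_mem i⟩

theorem not_isUnit_of_constantCoeff_eq_zero [Nontrivial k] {n : ℕ} {x : S.ring n}
    (hx : MvPowerSeries.constantCoeff x.1 = 0) : ¬ IsUnit x := fun h => by
  have := (h.map (S.ring n).val).map (MvPowerSeries.constantCoeff (σ := Fin n) (R := k))
  exact not_isUnit_zero (hx ▸ this)

theorem coordIdeal_ne_top [Nontrivial k] (n : ℕ) : S.coordIdeal n ≠ ⊤ := by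
  have hle : S.coordIdeal n ≤
      RingHom.ker ((MvPowerSeries.constantCoeff (σ := Fin n) (R := k)).comp
        (S.ring n).val.toRingHom) := by
    refine Ideal.span_le.mpr ?_
    rintro g ⟨i, hi⟩
    change MvPowerSeries.constantCoeff g.1 = 0
    rw [hi, MvPowerSeries.constantCoeff_X]
  exact fun h => RingHom.ker_ne_top _ (top_le_iff.mp (h ▸ hle))

theorem IsRegular.nontrivial (hR : S.IsRegular) : Nontrivial k := by
  have := hR.isLocalRing 0
  by_contra h
  rw [not_nontrivial_iff_subsingleton] at h
  exact not_subsingleton (S.ring 0) (Module.subsingleton k _)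

theorem IsRegular.isLocalRing_germRing (hR : S.IsRegular) {n : ℕ} {J : Ideal (S.ring n)}
    (hJ : J ≤ S.coordIdeal n) : IsLocalRing (S.GermRing J) := by
  have := hR.nontrivial
  have := hR.isLocalRing n
  have : Nontrivial (S.ring n ⧸ J) :=
    Ideal.Quotient.nontrivial_iff.mpr fun h => coordIdeal_ne_top n (top_le_iff.mp (h ▸ hJ))
  exact IsLocalRing.of_surjective' (Ideal.Quotient.mk J) Ideal.Quotient.mk_surjective

/-- The partial derivatives of the ring of power series. -/
def IsRegular.pderiv (hR : S.IsRegular) {n : ℕ} (i : Fin n) :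
    Derivation k (S.ring n) (S.ring n) :=
  Derivation.mk'
    (((MvPowerSeries.pderiv k i).toLinearMap.comp (S.ring n).val.toLinearMap).codRestrict
      (Subalgebra.toSubmodule (S.ring n)) fun g => hR.pderiv_mem i g.1 g.2)
    fun a b => Subtype.ext ((MvPowerSeries.pderiv k i).leibniz a.1 b.1)

theorem IsRegular.pderiv_coord_self (hR : S.IsRegular) {n : ℕ} (i : Fin n) :
    hR.pderiv i (hR.coord i) = 1 :=
  Subtype.ext MvPowerSeries.pderiv_X_self

theorem IsRegular.pderiv_coord_of_ne (hR : S.IsRegular) {n : ℕ} {i j : Fin n} (h : i ≠ j) :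
    hR.pderiv i (hR.coord j) = 0 :=
  Subtype.ext (MvPowerSeries.pderiv_X_of_ne h.symm)

/-- A coordinate has zero constant term and is not a unit, so a local map sends it into the maximal
ideal, as `eq_zero_of_leibniz` requires. -/
theorem IsRegular.leibnizDetermined_coord (hR : S.IsRegular) {n : ℕ} {C : Type u} [CommRing C]
    [Algebra k C] [IsLocalRing C] [IsNoetherianRing C] (φ : S.ring n →ₐ[k] C)
    (hφ : IsLocalHom φ) : LeibnizDetermined φ (hR.coord (n := n)) := by
  intro δ hδ h0 g
  have := hR.nontrivial
  refine hR.eq_zero_of_leibniz φ ?_ δ hδ ?_ g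
  · rintro x ⟨i, hi⟩
    rw [IsLocalRing.mem_maximalIdeal, mem_nonunits_iff]
    intro hu
    refine not_isUnit_of_constantCoeff_eq_zero (x := x) ?_
      (hφ.map_nonunit x hu)
    rw [hi, MvPowerSeries.constantCoeff_X]
  · rintro x ⟨i, hi⟩
    have : x = hR.coord i := Subtype.ext hi
    rw [this, h0]

theorem IsRegular.leibnizDetermined_coord_mk (hR : S.IsRegular) {n : ℕ} {J : Ideal (S.ring n)}
    [IsLocalRing (S.GermRing J)] {C : Type u} [CommRing C] [Algebra k C] [IsLocalRing C]
    [IsNoetherianRing C] (φ : S.GermRing J →ₐ[k] C) (hφ : IsLocalHom φ) :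
    LeibnizDetermined φ fun i => Ideal.Quotient.mkₐ k J (hR.coord i) := by
  have := hR.isLocalRing n
  have hq := isLocalHom_of_surjective (A := S.ring n) (B := S.GermRing J)
    (q := Ideal.Quotient.mkₐ k J) (Ideal.Quotient.mkₐ_surjective k J)
  exact LeibnizDetermined.of_surjective (A := S.ring n) (B := S.GermRing J) (φ := φ)
    (q := Ideal.Quotient.mkₐ k J) (Ideal.Quotient.mkₐ_surjective k J)
    (hR.leibnizDetermined_coord (φ.comp (Ideal.Quotient.mkₐ k J))
      (isLocalHom_algHom_comp (B := S.GermRing J) hφ hq))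

end Germ.SeriesSystem

theorem mainTheorem7 {k : Type u} [CommRing k] (S : Germ.SeriesSystem k) (hS : S.IsGermSystem)
    {n m m' : ℕ} (hm : m' ≤ m)
    (JX : Ideal (S.ring n)) (hJX : JX ≤ S.coordIdeal n)
    (JY : Ideal (S.ring m)) (hJY : JY ≤ S.coordIdeal m)
    (f : S.GermRing JY →ₐ[k] S.GermRing JX) (hlocal : IsLocalHom f)
    (hdominant : Function.Injective f)
    (hcovering : Germ.IsFiniteCovering (S.ring m') (S.GermRing JY) (S.projection hm JY).toRingHom)
    (hcrit : ∀ Z : Set (PrimeSpectrum (S.GermRing JX)),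
      Germ.IsIrreducibleComponentOf Z (Germ.critLocus k (S.GermRing JY) (S.GermRing JX) f) →
      ¬ Z ⊆ PrimeSpectrum.comap f.toRingHom ⁻¹'
        Germ.ramLocus (S.ring m') (S.GermRing JY) (S.projection hm JY).toRingHom)
    (hcrit' : ∀ Z : Set (PrimeSpectrum (S.GermRing JX)),
      Germ.IsIrreducibleComponentOf Z
        (Germ.critLocus k (S.ring m') (S.GermRing JX) (f.comp (S.projection hm JY))) →
      ¬ Z ⊆ PrimeSpectrum.comap f.toRingHom ⁻¹'
        Germ.ramLocus (S.ring m') (S.GermRing JY) (S.projection hm JY).toRingHom) :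
    Germ.critLocus k (S.GermRing JY) (S.GermRing JX) f =
      Germ.critLocus k (S.ring m') (S.GermRing JX) (f.comp (S.projection hm JY)) := by
  have hR := hS.isRegular
  have := hR.isLocalRing m'
  have := hR.isLocalRing m
  have := hR.isNoetherianRing m'
  have := hR.isNoetherianRing m
  have := hR.isNoetherianRing n
  have := hR.isLocalRing_germRing hJX
  have := hR.isLocalRing_germRing hJY
  have hπ : IsLocalHom (S.projection hm JY) := ⟨hcovering.isLocalHom.map_nonunit⟩
  have hx := hR.leibnizDetermined_coord (C := S.GermRing JX) (f.comp (S.projection hm JY))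
    (Germ.isLocalHom_algHom_comp (B := S.GermRing JY) (C := S.GermRing JX) hlocal hπ)
  have key := @Germ.IsFiniteCovering.critLocus_comp_eq k (S.ring m') (S.GermRing JY)
    (S.GermRing JX) _ _ _ _ _ _ _ _ _ _ _ _ (S.projection hm JY)
  exact @key hcovering f hlocal (Fin m') (Fin m) _ _ hR.coord hx _
    (hR.leibnizDetermined_coord_mk (C := S.GermRing JX) f hlocal) hR.pderiv hR.pderiv_coord_self
    (fun _ _ => hR.pderiv_coord_of_ne) hcrit hcrit'

end
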